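/- Let $n\ge 2$ be an integer and $\alpha>1$. Let $\psi\in C^\infty([0,+\infty))$ be a model function, i.e. $\psi>0$ on $(0,+\infty)$, $\psi(0)=0$, $\psi'(0)=1$ and $\psi^{(2k)}(0)=0$ for all $k\in\mathbb N$, and suppose that there are $\kappa_1,\kappa_2>0$ with $\kappa_1 r^\alpha\le\psi(r)\le\kappa_2 r^\alpha$ for all sufficiently large $r$. Let $\mathbb M^n$ be the associated model manifold with pole $o$, that is, $\mathbb R^n$ with $o$ the origin and with the Riemannian metric given in polar coordinates about $o$ by $dr^2+\psi(r)^2\,g_{\mathbb S^{n-1}}$, where $g_{\mathbb S^{n-1}}$ is the round metric of the unit sphere; let $\Delta$ be its Laplace–Beltrami operator and $B_R$ the open geodesic ball of radius $R$ centred at $o$. Put $$\tilde 2_\alpha=\frac{\alpha(n-1)+1}{\alpha(n-1)-1},\qquad 2^*_\alpha=\frac{2(\alpha(n-1)+1)}{\alpha(n-1)-1},$$ and let $q\in(\tilde 2_\alpha,\,2^*_\alpha-1)$. Suppose that the Lane–Emden equation $-\Delta u=u^q$, $u>0$ on $\mathbb M^n$, has a radial solution $u\in C^2(\mathbb M^n)$,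 where radial means that the function depends only on the geodesic distance from $o$. Then there exists $R>0$ such that the Dirichlet problem $$\begin{cases}-\Delta u=u^q,\ u>0 & \text{in } B_R,\\ u=0 & \text{on }\partial B_R,\end{cases}$$ has at least two distinct radial solutions $u\in C^2(B_R)\cap C(\overline{B_R})$. -/

import Mathlib

open Set Filter Topology MeasureTheory
open scoped ContDiff ENNReal

namespace ModelManifold

noncomputable section

/-- Model functions: `ψ` is smooth on `[0, ∞)`, positive on `(0, ∞)`, `ψ(0) = 0`, `ψ'(0) = 1`, and
all derivatives of even order vanish at `0`. Only the values of `ψ` on `[0, ∞)` matter. -/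
structure IsModelFunction (ψ : ℝ → ℝ) : Prop where
  smooth : ContDiffOn ℝ ∞ ψ (Ici 0)
  pos : ∀ r, 0 < r → 0 < ψ r
  zero : ψ 0 = 0
  deriv_zero : derivWithin ψ (Ici 0) 0 = 1
  even_deriv_zero : ∀ k : ℕ, iteratedDerivWithin (2 * k) ψ (Ici 0) 0 = 0

/-- `ψ(r)` is comparable to `r ^ α` for all large `r`. -/
def HasPowerGrowth (ψ : ℝ → ℝ) (α : ℝ) : Prop :=
  ∃ κ₁ κ₂ : ℝ, 0 < κ₁ ∧ 0 < κ₂ ∧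
    ∀ᶠ r in atTop, κ₁ * r ^ α ≤ ψ r ∧ ψ r ≤ κ₂ * r ^ α

/-- The exponent `(α (n - 1) + 1) / (α (n - 1) - 1)`. -/
def tildeTwo (n : ℕ) (α : ℝ) : ℝ :=
  (α * ((n : ℝ) - 1) + 1) / (α * ((n : ℝ) - 1) - 1)

/-- The exponent `2 (α (n - 1) + 1) / (α (n - 1) - 1)`. -/
def twoStar (n : ℕ) (α : ℝ) : ℝ :=
  2 * (α * ((n : ℝ) - 1) + 1) / (α * ((n : ℝ) - 1) - 1)

variable {n : ℕ}

/-- The metric `dr² + ψ(r)² g_{S^{n-1}}`, written in the Cartesian coordinates `x = r θ` of `ℝⁿ`,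
with the pole at the origin. With `r = ‖x‖`, the form `dr` applied to a tangent vector `v` at
`x ≠ 0` is `⟪x, v⟫ / r`, and `dθ` applied to `v` is `1 / r` times the component of `v` orthogonal
to `x`; hence the Gram matrix is `P + (ψ(r) / r)² (1 - P)`, with `P i j = x i * x j / r²`. At the
origin its limit is the identity matrix. -/
def metric (n : ℕ) (ψ : ℝ → ℝ) (x : EuclideanSpace ℝ (Fin n)) : Matrix (Fin n) (Fin n) ℝ :=
  if x = 0 then 1
  else Matrix.of fun i j =>
    x i * x j / ‖x‖ ^ 2 +
      (ψ ‖x‖ / ‖x‖) ^ 2 * ((1 : Matrix (Fin n) (Fin n) ℝ) i j - x i * x j / ‖x‖ ^ 2)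

/-- The `i`-th partial derivative of `f` at `x`. -/
def partialDeriv (i : Fin n) (f : EuclideanSpace ℝ (Fin n) → ℝ) (x : EuclideanSpace ℝ (Fin n)) :
    ℝ :=
  fderiv ℝ f x (EuclideanSpace.single i 1)

/-- The Laplace-Beltrami operator of a metric `g` on `ℝⁿ`,
`Δ u = (det g)^(-1/2) ∑ i, ∂ᵢ ((det g)^(1/2) ∑ j, g^{ij} ∂ⱼ u)`. -/
def laplaceBeltrami (g : EuclideanSpace ℝ (Fin n) → Matrix (Fin n) (Fin n) ℝ)
    (u : EuclideanSpace ℝ (Fin n) → ℝ) (x : EuclideanSpace ℝ (Fin n)) : ℝ :=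
  (√(g x).det)⁻¹ * ∑ i, partialDeriv i
    (fun y => √(g y).det * ∑ j, (g y)⁻¹ i j * partialDeriv j u y) x

/-- The length, with respect to `g`, of the curve `γ` on `[0, 1]`. -/
def curveLength (g : EuclideanSpace ℝ (Fin n) → Matrix (Fin n) (Fin n) ℝ)
    (γ : ℝ → EuclideanSpace ℝ (Fin n)) : ℝ≥0∞ :=
  ∫⁻ t in Ioo (0 : ℝ) 1,
    ENNReal.ofReal √(∑ i, ∑ j, g (γ t) i j * deriv γ t i * deriv γ t j)

/-- The geodesic distance of `g`: the infimum of the lengths of the `C¹` curves from `x` to `y`. -/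
def geodesicDist (g : EuclideanSpace ℝ (Fin n) → Matrix (Fin n) (Fin n) ℝ)
    (x y : EuclideanSpace ℝ (Fin n)) : ℝ≥0∞ :=
  ⨅ (γ : ℝ → EuclideanSpace ℝ (Fin n)) (_ : ContDiffOn ℝ 1 γ (Icc 0 1))
    (_ : γ 0 = x) (_ : γ 1 = y), curveLength g γ

/-- The open geodesic ball of radius `R` about the pole. -/
def geodesicBall (g : EuclideanSpace ℝ (Fin n) → Matrix (Fin n) (Fin n) ℝ) (R : ℝ) :
    Set (EuclideanSpace ℝ (Fin n)) :=
  {x | geodesicDist g 0 x < ENNReal.ofReal R}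

/-- The geodesic sphere of radius `R` about the pole, i.e. the boundary of the geodesic ball. -/
def geodesicSphere (g : EuclideanSpace ℝ (Fin n) → Matrix (Fin n) (Fin n) ℝ) (R : ℝ) :
    Set (EuclideanSpace ℝ (Fin n)) :=
  {x | geodesicDist g 0 x = ENNReal.ofReal R}

/-- On the set `s`, the function `u` depends only on the geodesic distance from the pole. -/
def IsRadialOn (g : EuclideanSpace ℝ (Fin n) → Matrix (Fin n) (Fin n) ℝ)
    (u : EuclideanSpace ℝ (Fin n) → ℝ) (s : Set (EuclideanSpace ℝ (Fin n))) : Prop :=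
  ∀ x ∈ s, ∀ y ∈ s, geodesicDist g 0 x = geodesicDist g 0 y → u x = u y

/-- `u` is a (classical) positive radial solution of `-Δ u = u ^ q` on the whole manifold. -/
structure IsGlobalPositiveRadialSolution
    (g : EuclideanSpace ℝ (Fin n) → Matrix (Fin n) (Fin n) ℝ) (q : ℝ)
    (u : EuclideanSpace ℝ (Fin n) → ℝ) : Prop where
  contDiff : ContDiff ℝ 2 u
  radial : IsRadialOn g u univ
  pos : ∀ x, 0 < u x
  equation : ∀ x, -laplaceBeltrami g u x = u x ^ q

/-- `u` is a (classical) radial solution of the Dirichlet problem `-Δ u = u ^ q`, `u > 0` in `B_R`,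
`u = 0` on `∂B_R`. Values of `u` outside the closed ball are irrelevant. -/
structure IsRadialDirichletSolution
    (g : EuclideanSpace ℝ (Fin n) → Matrix (Fin n) (Fin n) ℝ) (q R : ℝ)
    (u : EuclideanSpace ℝ (Fin n) → ℝ) : Prop where
  contDiffOn : ContDiffOn ℝ 2 u (geodesicBall g R)
  continuousOn : ContinuousOn u (geodesicBall g R ∪ geodesicSphere g R)
  radial : IsRadialOn g u (geodesicBall g R ∪ geodesicSphere g R)
  pos : ∀ x ∈ geodesicBall g R, 0 < u x
  equation : ∀ x ∈ geodesicBall g R, -laplaceBeltrami g u x = u x ^ q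
  boundary : ∀ x ∈ geodesicSphere g R, u x = 0

end

end ModelManifold

/-! A positive radial function with profile `v` solves `-Δ u = u ^ q` exactly when `v(r) = a - ∫₀ʳ
w(s)⁻¹ ∫₀ˢ w v^q ds`, where `w = ψ^(n-1)` and `a` is the height at the pole. Let `A` be the height
of the given global solution, and let `V_a` be the profile of height `a` for the nonlinearity `t ^
q` frozen outside `[0, A]`. Freezing makes it bounded and Lipschitz, so `V_a` exists globally and
depends continuously on `a`; for `a > 0` it is strictly decreasing.

The two solutions come from shooting (`IsRadialWeight.exists_two_dirichlet_profiles`). Suppose that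
some height `a' < A` gives a profile vanishing at a radius `R`, and take `T = R + 1`. Then
`V_{a'}(T) < 0`, whereas `V_A(T) > 0` because the global solution is positive, and `V_δ(T) > 0` for
tiny `δ` because `q > 1`. The intermediate value theorem gives one height below `a'` and one above
it whose profiles vanish at `T`; by monotonicity both are positive before `T`.

The height `a'` comes from `IsRadialWeight.exists_small_dirichlet_profile`. Put `d = α(n-1)`, so
that `w ≥ c r^d` and `∫₀ᴿ w ≤ C R^(d+1)`. The upper bound on `q` says that `(q-1)(d-1) < 4`, i.e.
`q` is subcritical in the volume dimension `d + 1`. Maximizing `∫ w G(u)` under an energy constraint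
on a large ball gives a solution of `-Δ u = l g(u)`. For a suitable scaling of the constraint, `l`
stays bounded while the energy tends to `0` as `R → ∞`; `IsRadialWeight.rpow_le_of_energy_le` then
makes the height small, and multiplication by a constant removes `l`. Convexity of `G` allows the
maximization to be carried out for a dual functional without derivatives, on a compact set of
Lipschitz functions.

The geometry enters through two facts: the distance to the pole is the Euclidean norm, and the
metric fixes the radial direction. `contDiff_and_equation_of_profile` and
`IsGlobalPositiveRadialSolution.exists_profile` translate between profiles and solutions. -/

namespace ModelManifold

/-! ### The mean flux and Picard iteration for the radial integral equation. -/

/-- A continuous weight on `ℝ`, positive away from the origin, vanishing at the origin, and almost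
increasing in `|r|`. -/
structure IsRadialWeight (w : ℝ → ℝ) (K : ℝ) : Prop where
  continuous : Continuous w
  zero : w 0 = 0
  pos : ∀ r, r ≠ 0 → 0 < w r
  const_pos : 0 < K
  almost_mono : ∀ t s, |t| ≤ |s| → w t ≤ K * w s

/-- The mean flux `w(s)⁻¹ ∫₀ˢ w h` of the source `h`. -/
noncomputable def avgFlux (w h : ℝ → ℝ) (s : ℝ) : ℝ :=
  (w s)⁻¹ * ∫ t in (0 : ℝ)..s, w t * h t

section Weight

variable {w : ℝ → ℝ} {K : ℝ}

theorem IsRadialWeight.nonneg (hw : IsRadialWeight w K) (r : ℝ) : 0 ≤ w r := by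
  rcases eq_or_ne r 0 with rfl | h
  · exact hw.zero.ge
  · exact (hw.pos r h).le

theorem avgFlux_zero (w h : ℝ → ℝ) : avgFlux w h 0 = 0 := by simp [avgFlux]

theorem IsRadialWeight.mul_avgFlux (hw : IsRadialWeight w K) (h : ℝ → ℝ) (s : ℝ) :
    w s * avgFlux w h s = ∫ t in (0 : ℝ)..s, w t * h t := by
  rcases eq_or_ne s 0 with rfl | hs
  · simp [hw.zero]
  · rw [avgFlux, mul_inv_cancel_left₀ (hw.pos s hs).ne']

theorem abs_le_of_mem_uIoc_zero {s t : ℝ} (ht : t ∈ uIoc 0 s) : |t| ≤ |s| := by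
  rcases le_total 0 s with h | h
  · rw [uIoc_of_le h] at ht
    rw [abs_of_pos ht.1, abs_of_nonneg h]
    exact ht.2
  · rw [uIoc_of_ge h] at ht
    rw [abs_of_nonpos ht.2, abs_of_nonpos h]
    linarith [ht.1]

/-- Almost monotonicity bounds `w t / w s` by `K` under the integral. The resulting linear decay at
the pole compensates the singular factor `1 / w`. -/
theorem IsRadialWeight.abs_avgFlux_le (hw : IsRadialWeight w K) {h : ℝ → ℝ} {s B : ℝ}
    (hB : ∀ t ∈ uIoc 0 s, |h t| ≤ B) : |avgFlux w h s| ≤ K * B * |s| := by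
  rcases eq_or_ne s 0 with rfl | hs
  · simp [avgFlux_zero]
  have hws := hw.pos s hs
  have h1 : ‖∫ t in (0 : ℝ)..s, w t * h t‖ ≤ (K * w s * B) * |s - 0| := by
    refine intervalIntegral.norm_integral_le_of_norm_le_const fun t ht => ?_
    rw [Real.norm_eq_abs, abs_mul, abs_of_nonneg (hw.nonneg t)]
    exact mul_le_mul (hw.almost_mono t s (abs_le_of_mem_uIoc_zero ht)) (hB t ht) (abs_nonneg _)
      (mul_nonneg hw.const_pos.le hws.le)
  rw [avgFlux, abs_mul, abs_inv, abs_of_pos hws, inv_mul_le_iff₀ hws]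
  rw [Real.norm_eq_abs, sub_zero] at h1
  linarith

theorem IsRadialWeight.intervalIntegrable (hw : IsRadialWeight w K) {h : ℝ → ℝ}
    (hh : Continuous h) (a b : ℝ) : IntervalIntegrable (fun t => w t * h t) volume a b :=
  (hw.continuous.mul hh).intervalIntegrable a b

theorem IsRadialWeight.avgFlux_sub (hw : IsRadialWeight w K) {h₁ h₂ : ℝ → ℝ}
    (hh₁ : Continuous h₁) (hh₂ : Continuous h₂) (s : ℝ) :
    avgFlux w h₁ s - avgFlux w h₂ s = avgFlux w (fun t => h₁ t - h₂ t) s := by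
  simp only [avgFlux, mul_sub]
  rw [intervalIntegral.integral_sub (hw.intervalIntegrable hh₁ _ _)
    (hw.intervalIntegrable hh₂ _ _)]
  ring

theorem avgFlux_const_mul (w h : ℝ → ℝ) (c s : ℝ) :
    avgFlux w (fun t => c * h t) s = c * avgFlux w h s := by
  simp only [avgFlux, mul_left_comm _ c, intervalIntegral.integral_const_mul]

theorem avgFlux_congr {w h₁ h₂ : ℝ → ℝ} {s : ℝ} (h : ∀ t ∈ uIoc 0 s, h₁ t = h₂ t) :
    avgFlux w h₁ s = avgFlux w h₂ s := by
  unfold avgFlux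
  congr 1
  exact intervalIntegral.integral_congr_ae (.of_forall fun t ht => by rw [h t ht])

/-- Joint continuity of the mean flux in a parameter and the endpoint. -/
theorem IsRadialWeight.continuous_avgFlux_uncurry (hw : IsRadialWeight w K) {X : Type*}
    [TopologicalSpace X] {h : X → ℝ → ℝ} (hh : Continuous (Function.uncurry h)) {B : ℝ}
    (hB : ∀ x t, |h x t| ≤ B) : Continuous fun z : X × ℝ => avgFlux w (h z.1) z.2 := by
  rw [continuous_iff_continuousAt]
  rintro ⟨x, s⟩
  rcases eq_or_ne s 0 with rfl | hs
  · have h0 : Tendsto (fun z : X × ℝ => K * B * |z.2|) (𝓝 (x, 0)) (𝓝 0) := by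
      have : Continuous fun z : X × ℝ => K * B * |z.2| := by fun_prop
      simpa using this.tendsto (x, 0)
    rw [ContinuousAt, avgFlux_zero]
    exact squeeze_zero_norm (fun z => hw.abs_avgFlux_le fun t _ => hB z.1 t) h0
  · have h1 : Continuous fun z : X × ℝ => ∫ t in (0 : ℝ)..z.2, w t * h z.1 t := by
      refine intervalIntegral.continuous_parametric_intervalIntegral_of_continuous
        (f := fun (z : X × ℝ) t => w t * h z.1 t) ?_ continuous_snd
      exact (hw.continuous.comp continuous_snd).mul
        (hh.comp ((continuous_fst.comp continuous_fst).prodMk continuous_snd))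
    have h2 : ContinuousAt (fun z : X × ℝ => (w z.2)⁻¹) (x, s) :=
      (hw.continuous.comp continuous_snd).continuousAt.inv₀ (hw.pos s hs).ne'
    exact h2.mul h1.continuousAt

theorem IsRadialWeight.continuous_avgFlux (hw : IsRadialWeight w K) {h : ℝ → ℝ}
    (hh : Continuous h) : Continuous (avgFlux w h) := by
  rw [continuous_iff_continuousAt]
  intro s
  rcases eq_or_ne s 0 with rfl | hs
  · obtain ⟨B, hB⟩ := (isCompact_Icc (a := (-1 : ℝ)) (b := 1)).exists_bound_of_continuousOn
      hh.continuousOn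
    have h0 : Tendsto (fun s : ℝ => K * B * |s|) (𝓝 0) (𝓝 0) := by
      have : Continuous fun s : ℝ => K * B * |s| := by fun_prop
      simpa using this.tendsto 0
    rw [ContinuousAt, avgFlux_zero]
    refine squeeze_zero_norm' ?_ h0
    filter_upwards [Icc_mem_nhds (show (-1 : ℝ) < 0 by norm_num) one_pos] with s hs
    refine hw.abs_avgFlux_le fun t ht => hB t ?_
    exact abs_le.1 ((abs_le_of_mem_uIoc_zero ht).trans (abs_le.2 hs))
  · have h1 : Continuous fun s => ∫ t in (0 : ℝ)..s, w t * h t :=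
      intervalIntegral.continuous_primitive (fun a b => hw.intervalIntegrable hh a b) 0
    exact (hw.continuous.continuousAt.inv₀ (hw.pos s hs).ne').mul h1.continuousAt

theorem IsRadialWeight.avgFlux_nonneg (hw : IsRadialWeight w K) {h : ℝ → ℝ} {s : ℝ} (hs : 0 ≤ s)
    (hh : ∀ t ∈ Icc 0 s, 0 ≤ h t) : 0 ≤ avgFlux w h s :=
  mul_nonneg (inv_nonneg.2 (hw.nonneg s))
    (intervalIntegral.integral_nonneg hs fun t ht => mul_nonneg (hw.nonneg t) (hh t ht))

theorem IsRadialWeight.avgFlux_pos (hw : IsRadialWeight w K) {h : ℝ → ℝ} {s : ℝ} (hs : 0 < s)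
    (hc : Continuous h) (hh : ∀ t ∈ Icc 0 s, 0 ≤ h t) (h0 : 0 < h 0) : 0 < avgFlux w h s := by
  refine mul_pos (inv_pos.2 (hw.pos s hs.ne')) ?_
  obtain ⟨δ, hδ, hδ'⟩ := Metric.eventually_nhds_iff.1 (hc.continuousAt.eventually (lt_mem_nhds h0))
  refine intervalIntegral.integral_pos hs (hw.continuous.mul hc).continuousOn
    (fun t ht => mul_nonneg (hw.nonneg t) (hh t ⟨ht.1.le, ht.2⟩)) ?_
  have hm : 0 < min (δ / 2) s := lt_min (by linarith) hs
  refine ⟨min (δ / 2) s, ⟨hm.le, min_le_right _ _⟩, mul_pos (hw.pos _ hm.ne') (hδ' ?_)⟩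
  rw [dist_zero_right, Real.norm_eq_abs, abs_of_pos hm]
  exact (min_le_left _ _).trans_lt (by linarith)

theorem IsRadialWeight.hasDerivAt_primitive (hw : IsRadialWeight w K) {h : ℝ → ℝ}
    (hh : Continuous h) (s : ℝ) :
    HasDerivAt (fun s => ∫ t in (0 : ℝ)..s, w t * h t) (w s * h s) s :=
  ((hw.continuous.mul hh).integral_hasStrictDerivAt 0 s).hasDerivAt

/-- `v` is the radial profile on `[0, T]`, with value `a` at the pole, of a solution of
`-Δ u = g ∘ u`. -/
def IsProfile (w g : ℝ → ℝ) (a T : ℝ) (v : ℝ → ℝ) : Prop :=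
  ∀ r ∈ Icc 0 T, v r = a - ∫ s in (0 : ℝ)..r, avgFlux w (fun t => g (v t)) s

theorem integral_mul_exp_sq {β : ℝ} (hβ : β ≠ 0) (r : ℝ) :
    ∫ s in (0 : ℝ)..r, s * Real.exp (β * s ^ 2) = (Real.exp (β * r ^ 2) - 1) / (2 * β) := by
  have : ∀ s ∈ uIcc 0 r, HasDerivAt (fun s => Real.exp (β * s ^ 2) / (2 * β))
      (s * Real.exp (β * s ^ 2)) s := by
    intro s _
    have h1 : HasDerivAt (fun s : ℝ => β * s ^ 2) (β * (2 * s)) s := by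
      simpa using (hasDerivAt_pow 2 s).const_mul β
    refine (h1.exp.div_const (2 * β)).congr_deriv ?_
    field_simp
  rw [intervalIntegral.integral_eq_sub_of_hasDerivAt this
    (by apply Continuous.intervalIntegrable; fun_prop)]
  simp
  ring

/-- The contraction estimate of Picard iteration in the weighted norm `sup e^{-β r²} |v|`. -/
theorem IsRadialWeight.abs_integral_avgFlux_sub_le (hw : IsRadialWeight w K) {g : ℝ → ℝ} {Λ : ℝ}
    (hΛ : 0 < Λ) (hgc : Continuous g) (hg : ∀ x y, |g x - g y| ≤ Λ * |x - y|) {v₁ v₂ : ℝ → ℝ}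
    (hv₁ : Continuous v₁) (hv₂ : Continuous v₂) {D r : ℝ} (hD : 0 ≤ D)
    (h : ∀ t ∈ uIcc 0 r, |v₁ t - v₂ t| ≤ D * Real.exp (K * Λ * t ^ 2)) :
    |(∫ s in (0 : ℝ)..r, avgFlux w (fun t => g (v₁ t)) s) -
      ∫ s in (0 : ℝ)..r, avgFlux w (fun t => g (v₂ t)) s| ≤
        D / 2 * Real.exp (K * Λ * r ^ 2) := by
  have hK := hw.const_pos
  have hβ : 0 < K * Λ := mul_pos hK hΛ
  have hg₁ : Continuous fun t => g (v₁ t) := hgc.comp hv₁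
  have hg₂ : Continuous fun t => g (v₂ t) := hgc.comp hv₂
  rw [← intervalIntegral.integral_sub ((hw.continuous_avgFlux hg₁).intervalIntegrable _ _)
    ((hw.continuous_avgFlux hg₂).intervalIntegrable _ _)]
  have hpt : ∀ s ∈ uIcc 0 r, |avgFlux w (fun t => g (v₁ t)) s - avgFlux w (fun t => g (v₂ t)) s| ≤
      |K * Λ * D * (s * Real.exp (K * Λ * s ^ 2))| := by
    intro s hs
    rw [hw.avgFlux_sub hg₁ hg₂]
    refine (hw.abs_avgFlux_le (B := Λ * (D * Real.exp (K * Λ * s ^ 2))) fun t ht => ?_).trans ?_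
    · refine (hg _ _).trans (mul_le_mul_of_nonneg_left ((h t ?_).trans ?_) hΛ.le)
      · exact uIcc_subset_uIcc left_mem_uIcc hs (uIoc_subset_uIcc ht)
      · refine mul_le_mul_of_nonneg_left (Real.exp_le_exp.2 ?_) hD
        exact mul_le_mul_of_nonneg_left (sq_le_sq.2 (abs_le_of_mem_uIoc_zero ht)) hβ.le
    · rw [abs_mul (K * Λ * D), abs_mul s, abs_of_nonneg (mul_nonneg hβ.le hD),
        abs_of_pos (Real.exp_pos _)]
      exact le_of_eq (by ring)
  have hint : ∀ r : ℝ, ∫ s in (0 : ℝ)..r, K * Λ * D * (s * Real.exp (K * Λ * s ^ 2)) =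
      D / 2 * (Real.exp (K * Λ * r ^ 2) - 1) := by
    intro r
    rw [intervalIntegral.integral_const_mul, integral_mul_exp_sq hβ.ne']
    field_simp
  have hle : abs (∫ s in (0 : ℝ)..r, |K * Λ * D * (s * Real.exp (K * Λ * s ^ 2))|) ≤
      D / 2 * (Real.exp (K * Λ * r ^ 2) - 1) := by
    have e1 : (1 : ℝ) ≤ Real.exp (K * Λ * r ^ 2) := Real.one_le_exp (by positivity)
    have e2 : 0 ≤ D / 2 * (Real.exp (K * Λ * r ^ 2) - 1) := mul_nonneg (by linarith) (by linarith)
    rcases le_total 0 r with hr | hr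
    · rw [intervalIntegral.integral_congr
        (g := fun s => K * Λ * D * (s * Real.exp (K * Λ * s ^ 2))), hint, abs_of_nonneg e2]
      intro s hs
      rw [uIcc_of_le hr] at hs
      exact abs_of_nonneg (mul_nonneg (mul_nonneg hβ.le hD)
        (mul_nonneg hs.1 (Real.exp_pos _).le))
    · rw [intervalIntegral.integral_congr
        (g := fun s => -(K * Λ * D * (s * Real.exp (K * Λ * s ^ 2)))),
        intervalIntegral.integral_neg, hint, abs_neg, abs_of_nonneg e2]
      intro s hs
      rw [uIcc_of_ge hr] at hs
      exact abs_of_nonpos (mul_nonpos_of_nonneg_of_nonpos (mul_nonneg hβ.le hD)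
        (mul_nonpos_of_nonpos_of_nonneg hs.2 (Real.exp_pos _).le))
  rw [← Real.norm_eq_abs]
  refine (intervalIntegral.norm_integral_le_abs_of_norm_le (g := fun s =>
    |K * Λ * D * (s * Real.exp (K * Λ * s ^ 2))|) ?_ ?_).trans (hle.trans ?_)
  · filter_upwards [ae_restrict_mem measurableSet_uIoc] with s hs
    exact hpt s (uIoc_subset_uIcc hs)
  · apply Continuous.intervalIntegrable
    fun_prop
  · nlinarith

/-- Banach's fixed point theorem for `y = e^{-β r²} v` with `β = K Λ`, on bounded continuous
functions on the whole line: in this norm the integral operator contracts by `1/2`. -/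
theorem IsRadialWeight.exists_profile (hw : IsRadialWeight w K) {g : ℝ → ℝ} {Λ B : ℝ}
    (hΛ : 0 < Λ) (hgc : Continuous g) (hg : ∀ x y, |g x - g y| ≤ Λ * |x - y|)
    (hB : ∀ x, |g x| ≤ B) (a : ℝ) :
    ∃ v : ℝ → ℝ, Continuous v ∧
      ∀ r, v r = a - ∫ s in (0 : ℝ)..r, avgFlux w (fun t => g (v t)) s := by
  have hK := hw.const_pos
  have hβ : 0 < K * Λ := mul_pos hK hΛ
  have hB0 : 0 ≤ B := (abs_nonneg _).trans (hB 0)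
  let lift : BoundedContinuousFunction ℝ ℝ → ℝ → ℝ := fun y t => Real.exp (K * Λ * t ^ 2) * y t
  have hlift : ∀ y, Continuous (lift y) := fun y => by
    have := y.continuous
    fun_prop
  let I : BoundedContinuousFunction ℝ ℝ → ℝ → ℝ := fun y r =>
    ∫ s in (0 : ℝ)..r, avgFlux w (fun t => g (lift y t)) s
  have hI : ∀ y, Continuous (I y) := fun y =>
    intervalIntegral.continuous_primitive (fun a b =>
      (hw.continuous_avgFlux (hgc.comp (hlift y))).intervalIntegrable a b) 0
  have hIb : ∀ y r, |I y r| ≤ K * B * |r| * |r| := by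
    intro y r
    have := intervalIntegral.norm_integral_le_of_norm_le_const (a := 0) (b := r)
      (f := avgFlux w (fun t => g (lift y t))) (C := K * B * |r|) fun s hs =>
        (hw.abs_avgFlux_le fun t _ => hB _).trans
          (mul_le_mul_of_nonneg_left (abs_le_of_mem_uIoc_zero hs) (mul_nonneg hK.le hB0))
    rwa [sub_zero] at this
  have hbd : ∀ y r, ‖Real.exp (-(K * Λ * r ^ 2)) * (a - I y r)‖ ≤ |a| + B / Λ := by
    intro y r
    rw [Real.norm_eq_abs, abs_mul, abs_of_pos (Real.exp_pos _)]
    have h1 := hIb y r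
    rw [mul_assoc, abs_mul_abs_self] at h1
    have h2 : |a - I y r| ≤ |a| + K * B * (r * r) := (abs_sub _ _).trans (by linarith)
    -- A bounded source makes the double integral grow at most like `K B r²`, which the Gaussian
    -- factor absorbs.
    have h3 : 1 + K * Λ * r ^ 2 ≤ Real.exp (K * Λ * r ^ 2) := by
      linarith [Real.add_one_le_exp (K * Λ * r ^ 2)]
    rw [Real.exp_neg, inv_mul_le_iff₀ (Real.exp_pos _)]
    refine h2.trans (le_trans ?_ (mul_le_mul_of_nonneg_right h3 (by positivity)))
    have h4 : (1 + K * Λ * r ^ 2) * (|a| + B / Λ) =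
        |a| + K * B * (r * r) + (B / Λ + K * Λ * r ^ 2 * |a|) := by
      field_simp
      ring
    rw [h4]
    have : 0 ≤ B / Λ + K * Λ * r ^ 2 * |a| := by positivity
    linarith
  let P : BoundedContinuousFunction ℝ ℝ → BoundedContinuousFunction ℝ ℝ := fun y =>
    BoundedContinuousFunction.ofNormedAddCommGroup
      (fun r => Real.exp (-(K * Λ * r ^ 2)) * (a - I y r))
      (by have := hI y; fun_prop) _ (hbd y)
  have hP : ContractingWith (1 / 2) P := by
    refine ⟨by norm_num, LipschitzWith.of_dist_le_mul fun y z => ?_⟩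
    rw [BoundedContinuousFunction.dist_le (by positivity)]
    intro r
    have h1 := hw.abs_integral_avgFlux_sub_le hΛ hgc hg (hlift z) (hlift y) (D := dist y z) (r := r)
      dist_nonneg (fun t _ => by
        change |Real.exp (K * Λ * t ^ 2) * z t - Real.exp (K * Λ * t ^ 2) * y t| ≤ _
        rw [← mul_sub, abs_mul, abs_of_pos (Real.exp_pos _), mul_comm, dist_comm]
        refine mul_le_mul_of_nonneg_right ?_ (Real.exp_pos _).le
        exact BoundedContinuousFunction.dist_coe_le_dist (f := z) (g := y) t)
    change |Real.exp (-(K * Λ * r ^ 2)) * (a - I y r) -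
      Real.exp (-(K * Λ * r ^ 2)) * (a - I z r)| ≤ _
    rw [← mul_sub, sub_sub_sub_cancel_left, abs_mul, abs_of_pos (Real.exp_pos _), Real.exp_neg,
      inv_mul_le_iff₀ (Real.exp_pos _)]
    refine h1.trans (le_of_eq ?_)
    push_cast
    ring
  obtain ⟨y, hy⟩ : ∃ y, P y = y := ⟨_, hP.fixedPoint_isFixedPt⟩
  refine ⟨lift y, hlift y, fun r => ?_⟩
  have h1 : Real.exp (-(K * Λ * r ^ 2)) * (a - I y r) = y r := DFunLike.congr_fun hy r
  change Real.exp (K * Λ * r ^ 2) * y r = a - I y r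
  rw [← h1, ← mul_assoc, ← Real.exp_add]
  simp

/-- The contraction estimate is applied where the weighted difference is maximal; half of the
maximum is absorbed, whence the factor `2`. This gives both uniqueness and continuity in the height.
-/
theorem IsRadialWeight.profile_sub_le (hw : IsRadialWeight w K) {g : ℝ → ℝ} {Λ : ℝ}
    (hΛ : 0 < Λ) (hgc : Continuous g) (hg : ∀ x y, |g x - g y| ≤ Λ * |x - y|) {a₁ a₂ T : ℝ}
    {v₁ v₂ : ℝ → ℝ} (hc₁ : Continuous v₁) (hc₂ : Continuous v₂)
    (hv₁ : IsProfile w g a₁ T v₁) (hv₂ : IsProfile w g a₂ T v₂) {r : ℝ} (hr : r ∈ Icc 0 T) :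
    |v₁ r - v₂ r| ≤ 2 * |a₁ - a₂| * Real.exp (K * Λ * r ^ 2) := by
  have hβ : 0 < K * Λ := mul_pos hw.const_pos hΛ
  obtain ⟨r₀, hr₀, hmax⟩ := isCompact_Icc.exists_isMaxOn (nonempty_of_mem hr)
    (f := fun r => Real.exp (-(K * Λ * r ^ 2)) * |v₁ r - v₂ r|) (by fun_prop)
  set D := Real.exp (-(K * Λ * r₀ ^ 2)) * |v₁ r₀ - v₂ r₀| with hD
  have hD0 : 0 ≤ D := by positivity
  have hpt : ∀ t ∈ Icc 0 T, |v₁ t - v₂ t| ≤ D * Real.exp (K * Λ * t ^ 2) := by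
    intro t ht
    have := hmax ht
    simp only [Set.mem_ofPred_eq, Real.exp_neg] at this
    rw [inv_mul_le_iff₀ (Real.exp_pos _)] at this
    rw [mul_comm, hD, Real.exp_neg]
    exact this
  have h1 := hw.abs_integral_avgFlux_sub_le hΛ hgc hg hc₁ hc₂ hD0 (r := r₀) (fun t ht => by
    rw [uIcc_of_le hr₀.1] at ht
    exact hpt t ⟨ht.1, ht.2.trans hr₀.2⟩)
  have h2 : |v₁ r₀ - v₂ r₀| ≤ |a₁ - a₂| + D / 2 * Real.exp (K * Λ * r₀ ^ 2) := by
    rw [hv₁ r₀ hr₀, hv₂ r₀ hr₀]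
    calc _ = |(a₁ - a₂) - ((∫ s in (0 : ℝ)..r₀, avgFlux w (fun t => g (v₁ t)) s) -
        ∫ s in (0 : ℝ)..r₀, avgFlux w (fun t => g (v₂ t)) s)| := by congr 1; ring
      _ ≤ _ := (abs_sub _ _).trans (by linarith)
  have h3 : D * Real.exp (K * Λ * r₀ ^ 2) = |v₁ r₀ - v₂ r₀| := by
    rw [hD, mul_right_comm, ← Real.exp_add]
    simp
  have h4 : 1 ≤ Real.exp (K * Λ * r₀ ^ 2) := Real.one_le_exp (by positivity)
  have h5 : D ≤ 2 * |a₁ - a₂| := by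
    have h6 : D / 2 * Real.exp (K * Λ * r₀ ^ 2) ≤ |a₁ - a₂| := by linarith
    nlinarith
  exact (hpt r hr).trans (mul_le_mul_of_nonneg_right h5 (Real.exp_pos _).le)

end Weight

/-! ### Weighted Cauchy–Schwarz inequality and convex primitives. -/

theorem intervalIntegral_mul_mul_le_sqrt_mul_sqrt {w f₁ f₂ : ℝ → ℝ} (hw : Continuous w)
    (hw0 : ∀ r, 0 ≤ w r) (h₁ : Continuous f₁) (h₂ : Continuous f₂) {a b : ℝ} (hab : a ≤ b) :
    ∫ s in a..b, w s * (f₁ s * f₂ s) ≤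
      √(∫ s in a..b, w s * f₁ s ^ 2) * √(∫ s in a..b, w s * f₂ s ^ 2) := by
  have hn : ∀ f : ℝ → ℝ, 0 ≤ ∫ s in a..b, w s * f s ^ 2 := fun f =>
    intervalIntegral.integral_nonneg hab fun s _ => mul_nonneg (hw0 s) (sq_nonneg _)
  have key : ∀ x : ℝ, 0 ≤ (∫ s in a..b, w s * f₁ s ^ 2) * (x * x) +
      (2 * ∫ s in a..b, w s * (f₁ s * f₂ s)) * x + ∫ s in a..b, w s * f₂ s ^ 2 := by
    intro x
    have h := hn fun s => x * f₁ s + f₂ s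
    have e : ∀ s, w s * (x * f₁ s + f₂ s) ^ 2 =
        (x * x) * (w s * f₁ s ^ 2) + (2 * x) * (w s * (f₁ s * f₂ s)) + w s * f₂ s ^ 2 :=
      fun s => by ring
    simp only [e] at h
    rw [intervalIntegral.integral_add, intervalIntegral.integral_add,
      intervalIntegral.integral_const_mul, intervalIntegral.integral_const_mul] at h
    · linarith
    all_goals
      apply Continuous.intervalIntegrable
      fun_prop
  have hd := discrim_le_zero key
  rw [discrim] at hd
  rw [← Real.sqrt_mul (hn f₁)]
  exact Real.le_sqrt_of_sq_le (by nlinarith)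

section Primitive

variable {g : ℝ → ℝ}

theorem hasDerivAt_primitive (hg : Continuous g) (x : ℝ) :
    HasDerivAt (fun x => ∫ t in (0 : ℝ)..x, g t) (g x) x :=
  (hg.integral_hasStrictDerivAt 0 x).hasDerivAt

theorem continuous_primitive_of_continuous (hg : Continuous g) :
    Continuous fun x => ∫ t in (0 : ℝ)..x, g t :=
  continuous_iff_continuousAt.2 fun x => (hasDerivAt_primitive hg x).continuousAt

/-- The primitive of a monotone function lies above its tangents. -/
theorem primitive_tangent_le (hg : Continuous g) (hm : Monotone g) (x y : ℝ) :
    (∫ t in (0 : ℝ)..x, g t) + g x * (y - x) ≤ ∫ t in (0 : ℝ)..y, g t := by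
  have hi : ∀ a b, IntervalIntegrable g volume a b := fun a b => hg.intervalIntegrable a b
  rw [← intervalIntegral.integral_add_adjacent_intervals (hi 0 x) (hi x y)]
  have hc : ∀ a b : ℝ, ∫ _ in a..b, g x = g x * (b - a) := fun a b => by simp [mul_comm]
  rcases le_total x y with h | h
  · have := intervalIntegral.integral_mono_on h intervalIntegrable_const (hi x y)
      (fun t ht => hm ht.1)
    rw [hc] at this
    linarith
  · have := intervalIntegral.integral_mono_on h (hi y x) intervalIntegrable_const
      (fun t ht => hm ht.2)
    rw [hc] at this
    rw [intervalIntegral.integral_symm y x]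
    linarith

/-- If the tangent at `x` touches the primitive again at `y`, then the slopes agree. -/
theorem eq_of_primitive_tangent_eq (hg : Continuous g) (hm : Monotone g) {x y : ℝ}
    (h : ∫ t in (0 : ℝ)..y, g t = (∫ t in (0 : ℝ)..x, g t) + g x * (y - x)) : g y = g x := by
  have h1 : HasDerivAt (fun z => (∫ t in (0 : ℝ)..z, g t) - g x * (z - x)) (g y - g x * 1) y :=
    (hasDerivAt_primitive hg y).sub (((hasDerivAt_id y).sub_const x).const_mul (g x))
  -- The excess of the primitive over its tangent is nonnegative and vanishes at `y`, so `y` is a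
  -- minimum.
  have h2 : IsLocalMin (fun z => (∫ t in (0 : ℝ)..z, g t) - g x * (z - x)) y :=
    .of_forall fun z => by
      have := primitive_tangent_le hg hm x z
      simp only [h]
      linarith
  have := h2.hasDerivAt_eq_zero h1
  linarith

end Primitive

/-! ### Constrained maximization through a dual functional. -/

section Variational

variable {w : ℝ → ℝ} {K : ℝ}

/-- Integration by parts; the boundary terms vanish because the primitive of `w h` is zero at `0`
and the tail of `f` is zero at `R`. -/
theorem IsRadialWeight.integral_mul_tail (hw : IsRadialWeight w K) {h f : ℝ → ℝ}
    (hh : Continuous h) (hf : Continuous f) (R : ℝ) :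
    ∫ r in (0 : ℝ)..R, w r * h r * ∫ s in r..R, f s =
      ∫ r in (0 : ℝ)..R, w r * (avgFlux w h r * f r) := by
  have hp : ∀ r, HasDerivAt (fun r => ∫ t in (0 : ℝ)..r, w t * h t) (w r * h r) r :=
    hw.hasDerivAt_primitive hh
  have hu : ∀ r, HasDerivAt (fun r => ∫ s in r..R, f s) (-f r) r := fun r =>
    intervalIntegral.integral_hasDerivAt_left (hf.intervalIntegrable _ _)
      (hf.stronglyMeasurableAtFilter _ _) hf.continuousAt
  have hcp : Continuous fun r => ∫ t in (0 : ℝ)..r, w t * h t :=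
    continuous_iff_continuousAt.2 fun r => (hp r).continuousAt
  have hcu : Continuous fun r => ∫ s in r..R, f s :=
    continuous_iff_continuousAt.2 fun r => (hu r).continuousAt
  have hcw := hw.continuous
  have key := intervalIntegral.integral_deriv_mul_eq_sub (a := 0) (b := R) (fun r _ => hp r)
    (fun r _ => hu r) ((hcw.mul hh).intervalIntegrable _ _) (hf.neg.intervalIntegrable _ _)
  rw [intervalIntegral.integral_add (by apply Continuous.intervalIntegrable; fun_prop)
    (by apply Continuous.intervalIntegrable; fun_prop)] at key
  simp only [intervalIntegral.integral_same, mul_zero, zero_mul, sub_zero, mul_neg,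
    intervalIntegral.integral_neg] at key
  simp only [← mul_assoc, hw.mul_avgFlux]
  linarith

/-- The weighted `L²` norm on `[0, R]` of the flux generated by `g ∘ v`. -/
noncomputable def fluxNorm (w g : ℝ → ℝ) (R : ℝ) (v : ℝ → ℝ) : ℝ :=
  √(∫ s in (0 : ℝ)..R, w s * avgFlux w (fun t => g (v t)) s ^ 2)

/-- The dual functional of the problem of maximizing `∫ w G(u)`, where `G' = g`, among the functions
`u` with `u(R) = 0` and `∫ w |u'|² ≤ ρ²`. -/
noncomputable def dualFunctional (w g : ℝ → ℝ) (R ρ : ℝ) (v : ℝ → ℝ) : ℝ :=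
  ρ * fluxNorm w g R v - ∫ s in (0 : ℝ)..R, w s * (g (v s) * v s - ∫ t in (0 : ℝ)..v s, g t)

/-- The dual functional at `v` bounds `∫ w (G(v) + g(v)(u - v))` over admissible `u`; here `v = u`.
After integration by parts the bound is Cauchy–Schwarz. -/
theorem IsRadialWeight.integral_primitive_le_dualFunctional (hw : IsRadialWeight w K) {g : ℝ → ℝ}
    (hg : Continuous g) {R ρ : ℝ} (hR : 0 ≤ R) (hρ : 0 ≤ ρ) {f u : ℝ → ℝ} (hf : Continuous f)
    (hu : Continuous u) (huf : ∀ r ∈ Icc 0 R, u r = ∫ s in r..R, f s)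
    (hfρ : ∫ s in (0 : ℝ)..R, w s * f s ^ 2 ≤ ρ ^ 2) :
    ∫ s in (0 : ℝ)..R, w s * ∫ t in (0 : ℝ)..u s, g t ≤ dualFunctional w g R ρ u := by
  have hgu : Continuous fun t => g (u t) := hg.comp hu
  have hGu : Continuous fun s => ∫ t in (0 : ℝ)..u s, g t :=
    (continuous_primitive_of_continuous hg).comp hu
  have hcw := hw.continuous
  have h1 : ∫ s in (0 : ℝ)..R, w s * (g (u s) * u s) ≤ ρ * fluxNorm w g R u := by
    calc _ = ∫ s in (0 : ℝ)..R, w s * g (u s) * ∫ t in s..R, f t := by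
          refine intervalIntegral.integral_congr fun s hs => ?_
          rw [uIcc_of_le hR] at hs
          simp only [← huf s hs, mul_assoc]
      _ = _ := hw.integral_mul_tail hgu hf R
      _ ≤ _ := intervalIntegral_mul_mul_le_sqrt_mul_sqrt hcw hw.nonneg
        (hw.continuous_avgFlux hgu) hf hR
      _ ≤ fluxNorm w g R u * ρ := mul_le_mul_of_nonneg_left (Real.sqrt_le_iff.2 ⟨hρ, hfρ⟩)
        (Real.sqrt_nonneg _)
      _ = _ := mul_comm _ _
  rw [dualFunctional]
  simp only [mul_sub]
  rw [intervalIntegral.integral_sub]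
  · linarith
  all_goals
    apply Continuous.intervalIntegrable
    fun_prop

/-- The equality case of Cauchy–Schwarz: `-u'` is the flux of `g ∘ v` rescaled to energy `ρ ^ 2`, so
`u` is the best competitor for the linearization at `v`. -/
theorem IsRadialWeight.dualFunctional_eq (hw : IsRadialWeight w K) {g : ℝ → ℝ}
    (hg : Continuous g) {R ρ : ℝ} {u v : ℝ → ℝ} (hR : 0 ≤ R)
    (hv : Continuous v) (hu : Continuous u) (hN : 0 < fluxNorm w g R v)
    (huv : ∀ r ∈ Icc 0 R, u r =
      ∫ s in r..R, ρ / fluxNorm w g R v * avgFlux w (fun t => g (v t)) s) :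
    dualFunctional w g R ρ v =
      ∫ s in (0 : ℝ)..R, w s * ((∫ t in (0 : ℝ)..v s, g t) + g (v s) * (u s - v s)) := by
  have hgv : Continuous fun t => g (v t) := hg.comp hv
  have hGv : Continuous fun s => ∫ t in (0 : ℝ)..v s, g t :=
    (continuous_primitive_of_continuous hg).comp hv
  have hcw := hw.continuous
  have hk := hw.continuous_avgFlux hgv
  have h1 : ∫ s in (0 : ℝ)..R, w s * (g (v s) * u s) = ρ * fluxNorm w g R v := by
    calc _ = ∫ s in (0 : ℝ)..R, w s * g (v s) * ∫ t in s..R,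
            ρ / fluxNorm w g R v * avgFlux w (fun t => g (v t)) t := by
          refine intervalIntegral.integral_congr fun s hs => ?_
          rw [uIcc_of_le hR] at hs
          simp only [← huv s hs, mul_assoc]
      _ = _ := hw.integral_mul_tail hgv (hk.const_mul _) R
      _ = ρ / fluxNorm w g R v * ∫ s in (0 : ℝ)..R, w s * avgFlux w (fun t => g (v t)) s ^ 2 := by
          rw [← intervalIntegral.integral_const_mul]
          exact intervalIntegral.integral_congr fun s _ => by ring
      _ = ρ / fluxNorm w g R v * fluxNorm w g R v ^ 2 := by
          rw [fluxNorm, Real.sq_sqrt]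
          exact intervalIntegral.integral_nonneg hR fun s _ =>
            mul_nonneg (hw.nonneg s) (sq_nonneg _)
      _ = _ := by field_simp
  rw [dualFunctional, ← h1, ← intervalIntegral.integral_sub]
  · exact intervalIntegral.integral_congr fun s _ => by ring
  all_goals
    apply Continuous.intervalIntegrable
    fun_prop

theorem isCompact_lipschitz_bounded (R L M : ℝ) :
    IsCompact {v : BoundedContinuousFunction (Icc 0 R) ℝ |
      (∀ x, v x ∈ Icc 0 M) ∧ ∀ x y, dist (v x) (v y) ≤ L * dist x y} := by
  refine BoundedContinuousFunction.arzela_ascoli₂ (Icc 0 M) isCompact_Icc _ ?_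
    (fun f x hf => hf.1 x) ?_
  · have he : ∀ x : Icc 0 R, Continuous fun v : BoundedContinuousFunction (Icc 0 R) ℝ => v x :=
      fun x => continuous_eval_const x
    rw [show {v : BoundedContinuousFunction (Icc 0 R) ℝ |
        (∀ x, v x ∈ Icc 0 M) ∧ ∀ x y, dist (v x) (v y) ≤ L * dist x y} =
        (⋂ x, {v | v x ∈ Icc 0 M}) ∩ ⋂ x, ⋂ y, {v | dist (v x) (v y) ≤ L * dist x y} by
      ext; simp only [mem_inter_iff, mem_iInter]; rfl]
    refine (isClosed_iInter fun x => isClosed_Icc.preimage (he x)).inter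
      (isClosed_iInter fun x => isClosed_iInter fun y => ?_)
    exact isClosed_le ((he x).dist (he y)) continuous_const
  · refine Metric.equicontinuous_of_continuity_modulus (fun t => L * t) ?_ _
      fun x y f => f.2.2 x y
    have : Continuous fun t : ℝ => L * t := by fun_prop
    simpa using this.tendsto 0

/-- The functional sees `v` only through its values and integrals of them, never through `v'`;
uniform convergence is therefore enough, and Arzelà–Ascoli provides maximizers. -/
theorem IsRadialWeight.continuous_dualFunctional (hw : IsRadialWeight w K) {g : ℝ → ℝ}
    (hg : Continuous g) {B : ℝ} (hB : ∀ x, |g x| ≤ B) {R : ℝ} (hR : 0 ≤ R) (ρ : ℝ) :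
    Continuous fun v : BoundedContinuousFunction (Icc 0 R) ℝ =>
      dualFunctional w g R ρ (IccExtend hR v) := by
  have hev : Continuous fun z : BoundedContinuousFunction (Icc 0 R) ℝ × ℝ =>
      IccExtend hR z.1 z.2 :=
    continuous_eval.comp
      (continuous_fst.prodMk ((continuous_projIcc (h := hR)).comp continuous_snd))
  have hcw := hw.continuous
  have hG := continuous_primitive_of_continuous hg
  have h1 := hw.continuous_avgFlux_uncurry
    (h := fun (v : BoundedContinuousFunction (Icc 0 R) ℝ) t => g (IccExtend hR v t))
    (hg.comp hev) (fun v t => hB _)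
  refine (Continuous.const_mul (Continuous.sqrt ?_) _).sub ?_
  · refine intervalIntegral.continuous_parametric_intervalIntegral_of_continuous' ?_ _ _
    exact (hcw.comp continuous_snd).mul (h1.pow 2)
  · refine intervalIntegral.continuous_parametric_intervalIntegral_of_continuous' ?_ _ _
    exact (hcw.comp continuous_snd).mul (((hg.comp hev).mul hev).sub (hG.comp hev))

/-- A maximizer of `∫ w G(u)` under the constraint `∫ w |u'|² ≤ ρ²` yields a solution of
`-Δ u = l g(u)` in the ball of radius `R`, with a multiplier controlled by any affine competitor. -/
theorem IsRadialWeight.exists_multiplier_solution (hw : IsRadialWeight w K) {g : ℝ → ℝ}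
    (hg : Continuous g) (hm : Monotone g) (hg0 : ∀ x, 0 ≤ g x) {B : ℝ} (hB : ∀ x, g x ≤ B)
    {R ρ b m : ℝ} (hR : 0 < R) (hρ : 0 < ρ) (hb : 0 < b)
    (hbρ : ∫ s in (0 : ℝ)..R, w s * (b / R) ^ 2 ≤ ρ ^ 2) (hm0 : 0 < m)
    (hmb : m ≤ ∫ s in (0 : ℝ)..R, w s * ∫ t in (0 : ℝ)..b / R * (R - s), g t) :
    ∃ (u : ℝ → ℝ) (l : ℝ), Continuous u ∧ 0 < l ∧ l * m ≤ ρ ^ 2 ∧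
      (∀ r ∈ Icc 0 R, u r = ∫ s in r..R, l * avgFlux w (fun t => g (u t)) s) ∧
      ∫ s in (0 : ℝ)..R, w s * (l * avgFlux w (fun t => g (u t)) s) ^ 2 = ρ ^ 2 := by
  have hK := hw.const_pos
  have hcw := hw.continuous
  have hB' : ∀ x, |g x| ≤ B := fun x => by rw [abs_of_nonneg (hg0 x)]; exact hB x
  have hB0 : 0 ≤ B := (hg0 0).trans (hB 0)
  have hG := continuous_primitive_of_continuous hg
  set L : ℝ := max (ρ ^ 2 * (K * B * R) / m) (b / R) with hL
  have hL0 : 0 ≤ L := le_max_of_le_right (by positivity)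
  set S := {v : BoundedContinuousFunction (Icc 0 R) ℝ |
      (∀ x, v x ∈ Icc 0 (L * R)) ∧ ∀ x y, dist (v x) (v y) ≤ L * dist x y} with hS
  have hmem : ∀ f : ℝ → ℝ, Continuous f → (∀ s ∈ Icc 0 R, f s ∈ Icc 0 L) →
      ∃ v ∈ S, ∀ r ∈ Icc 0 R, IccExtend hR.le v r = ∫ s in r..R, f s := by
    intro f hf hfL
    have hi : ∀ a b, IntervalIntegrable f volume a b := fun a b => hf.intervalIntegrable a b
    have hc : Continuous fun r => ∫ s in r..R, f s := by
      have := (intervalIntegral.continuous_primitive hi R).neg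
      exact this.congr fun r => (intervalIntegral.integral_symm R r).symm
    have hdiff : ∀ x ∈ Icc 0 R, ∀ y ∈ Icc 0 R, x ≤ y →
        0 ≤ ∫ s in x..y, f s ∧ ∫ s in x..y, f s ≤ L * (y - x) := by
      intro x hx y hy hxy
      have hsub : ∀ s ∈ Icc x y, s ∈ Icc 0 R := fun s hs => ⟨hx.1.trans hs.1, hs.2.trans hy.2⟩
      refine ⟨intervalIntegral.integral_nonneg hxy fun s hs => (hfL s (hsub s hs)).1, ?_⟩
      have := intervalIntegral.integral_mono_on hxy (hi x y) (intervalIntegrable_const (c := L))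
        fun s hs => (hfL s (hsub s hs)).2
      simpa [mul_comm] using this
    have hRm : R ∈ Icc 0 R := right_mem_Icc.2 hR.le
    refine ⟨BoundedContinuousFunction.mkOfCompact
      ⟨fun x : Icc 0 R => ∫ s in (x : ℝ)..R, f s, hc.comp continuous_subtype_val⟩,
      ⟨fun x => ?_, fun x y => ?_⟩, fun r hr => ?_⟩
    · have := hdiff x x.2 R hRm x.2.2
      refine ⟨this.1, this.2.trans (mul_le_mul_of_nonneg_left ?_ hL0)⟩
      linarith [x.2.1]
    · wlog hxy : (x : ℝ) ≤ y generalizing x y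
      · rw [dist_comm, dist_comm x]
        exact this y x (le_of_not_ge hxy)
      have := hdiff x x.2 y y.2 hxy
      have e := intervalIntegral.integral_add_adjacent_intervals (hi x y) (hi y R)
      rw [Real.dist_eq, Subtype.dist_eq, Real.dist_eq, abs_sub_comm (x : ℝ),
        abs_of_nonneg (sub_nonneg.2 hxy)]
      change |(∫ s in (x : ℝ)..R, f s) - ∫ s in (y : ℝ)..R, f s| ≤ _
      rw [← e, add_sub_cancel_right, abs_of_nonneg this.1]
      exact this.2
    · rw [IccExtend_of_mem _ _ hr]
      rfl
  obtain ⟨v₀, hv₀S, hv₀⟩ := hmem (fun _ => b / R) continuous_const fun s _ =>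
    ⟨by positivity, le_max_right _ _⟩
  obtain ⟨v, hvS, hvmax⟩ := (isCompact_lipschitz_bounded R L (L * R)).exists_isMaxOn ⟨v₀, hv₀S⟩
    (hw.continuous_dualFunctional hg hB' hR.le ρ).continuousOn
  set V := IccExtend hR.le v with hV
  have hVc : Continuous V := v.continuous.Icc_extend'
  have hmax : ∀ u ∈ S, dualFunctional w g R ρ (IccExtend hR.le u) ≤ dualFunctional w g R ρ V :=
    fun u hu => hvmax hu
  have hΨm : m ≤ dualFunctional w g R ρ V := by
    refine hmb.trans (le_trans (le_of_eq ?_) ((hw.integral_primitive_le_dualFunctional hg hR.le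
      hρ.le continuous_const v₀.continuous.Icc_extend' hv₀ hbρ).trans (hmax v₀ hv₀S)))
    refine intervalIntegral.integral_congr fun s hs => ?_
    rw [uIcc_of_le hR.le] at hs
    rw [hv₀ s hs, intervalIntegral.integral_const, smul_eq_mul, mul_comm (b / R)]
  have hgV : Continuous fun t => g (V t) := hg.comp hVc
  have hk := hw.continuous_avgFlux hgV
  set N := fluxNorm w g R V with hN
  -- The subtracted integrand `g(V) V - G(V)` is nonnegative by convexity and `G(0) = 0`. Hence the
  -- multiplier `ρ / N` is at most `ρ ^ 2 / m`.
  have hNm : m ≤ ρ * N := by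
    have : 0 ≤ ∫ s in (0 : ℝ)..R, w s * (g (V s) * V s - ∫ t in (0 : ℝ)..V s, g t) := by
      refine intervalIntegral.integral_nonneg hR.le fun s _ => mul_nonneg (hw.nonneg s) ?_
      have := primitive_tangent_le hg hm (V s) 0
      rw [intervalIntegral.integral_same] at this
      linarith
    rw [dualFunctional] at hΨm
    linarith
  have hN0 : 0 < N := by
    by_contra h
    nlinarith
  have hl0 : 0 < ρ / N := div_pos hρ hN0
  have hlm : ρ / N ≤ ρ ^ 2 / m := by
    rw [div_le_div_iff₀ hN0 hm0]
    nlinarith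
  obtain ⟨v₁, hv₁S, hv₁⟩ := hmem (fun s => ρ / N * avgFlux w (fun t => g (V t)) s)
    (hk.const_mul _) fun s hs => ⟨mul_nonneg hl0.le (hw.avgFlux_nonneg hs.1 fun t _ => hg0 _), by
      refine le_max_of_le_left ?_
      have h1 : avgFlux w (fun t => g (V t)) s ≤ K * B * R := by
        refine (le_abs_self _).trans ((hw.abs_avgFlux_le fun t _ => hB' _).trans ?_)
        rw [abs_of_nonneg hs.1]
        exact mul_le_mul_of_nonneg_left hs.2 (by positivity)
      calc _ ≤ ρ ^ 2 / m * (K * B * R) := mul_le_mul hlm h1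
            (hw.avgFlux_nonneg hs.1 fun t _ => hg0 _) (by positivity)
        _ = _ := by ring⟩
  set U := IccExtend hR.le v₁ with hU
  have hUc : Continuous U := v₁.continuous.Icc_extend'
  have hnorm : ∫ s in (0 : ℝ)..R, w s * (ρ / N * avgFlux w (fun t => g (V t)) s) ^ 2 = ρ ^ 2 := by
    calc _ = (ρ / N) ^ 2 * ∫ s in (0 : ℝ)..R, w s * avgFlux w (fun t => g (V t)) s ^ 2 := by
          rw [← intervalIntegral.integral_const_mul]
          exact intervalIntegral.integral_congr fun s _ => by ring
      _ = (ρ / N) ^ 2 * N ^ 2 := by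
          rw [hN, fluxNorm, Real.sq_sqrt]
          exact intervalIntegral.integral_nonneg hR.le fun s _ =>
            mul_nonneg (hw.nonneg s) (sq_nonneg _)
      _ = _ := by field_simp
  have h1 := hw.dualFunctional_eq (ρ := ρ) hg hR.le hVc hUc hN0 hv₁
  have h2 := (hw.integral_primitive_le_dualFunctional hg hR.le hρ.le (hk.const_mul _) hUc hv₁
    hnorm.le).trans (hmax v₁ hv₁S)
  have hGU : Continuous fun s => ∫ t in (0 : ℝ)..U s, g t := hG.comp hUc
  have hGV : Continuous fun s => ∫ t in (0 : ℝ)..V s, g t := hG.comp hVc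
  have hgap : ∀ s, 0 ≤ w s * ((∫ t in (0 : ℝ)..U s, g t) -
      ((∫ t in (0 : ℝ)..V s, g t) + g (V s) * (U s - V s))) := fun s =>
    mul_nonneg (hw.nonneg s) (sub_nonneg.2 (primitive_tangent_le hg hm (V s) (U s)))
  -- With `Ψ` the dual functional, `Ψ(V) = ∫ w (G(V) + g(V)(U - V)) ≤ ∫ w G(U) ≤ Ψ(U) ≤ Ψ(V)`.
  -- Equality throughout makes the tangent at `V s` touch `G` at `U s` for every `s > 0`, so `U` and
  -- `V` generate the same flux.
  have heq : ∀ s ∈ Ioc 0 R, g (U s) = g (V s) := by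
    intro s hs
    refine eq_of_primitive_tangent_eq hg hm (le_antisymm ?_ (primitive_tangent_le hg hm _ _))
    by_contra! hlt
    have hpos := intervalIntegral.integral_pos hR
      (f := fun s => w s * ((∫ t in (0 : ℝ)..U s, g t) -
        ((∫ t in (0 : ℝ)..V s, g t) + g (V s) * (U s - V s)))) (by fun_prop)
      (fun s _ => hgap s) ⟨s, Ioc_subset_Icc_self hs, mul_pos (hw.pos s hs.1.ne')
        (sub_pos.2 hlt)⟩
    simp only [mul_sub (w _) (∫ t in (0 : ℝ)..U _, g t)] at hpos
    rw [intervalIntegral.integral_sub, ← h1] at hpos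
    · linarith
    all_goals
      apply Continuous.intervalIntegrable
      fun_prop
  have hkeq : ∀ s ∈ Icc 0 R, avgFlux w (fun t => g (V t)) s = avgFlux w (fun t => g (U t)) s :=
    fun s hs => avgFlux_congr fun t ht => by
      rw [uIoc_of_le hs.1] at ht
      exact (heq t ⟨ht.1, ht.2.trans hs.2⟩).symm
  refine ⟨U, ρ / N, hUc, hl0, (le_div_iff₀ hm0).1 hlm, fun r hr => ?_, ?_⟩
  · rw [hv₁ r hr]
    refine intervalIntegral.integral_congr fun s hs => ?_
    rw [uIcc_of_le hr.2] at hs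
    simp only [hkeq s ⟨hr.1.trans hs.1, hs.2⟩]
  · rw [← hnorm]
    refine intervalIntegral.integral_congr fun s hs => ?_
    rw [uIcc_of_le hR.le] at hs
    simp only [hkeq s hs]

end Variational

/-! ### The truncated power nonlinearity. -/

section TruncatedPower

/-- The function `t ↦ t ^ q`, frozen outside `[0, A]`. -/
noncomputable def truncPow (q A t : ℝ) : ℝ := (min (max t 0) A) ^ q

variable {q A : ℝ}

theorem truncPow_of_mem {t : ℝ} (ht : t ∈ Icc 0 A) : truncPow q A t = t ^ q := by
  rw [truncPow, max_eq_left ht.1, min_eq_left ht.2]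

theorem clamp_mem (hA : 0 ≤ A) (t : ℝ) : min (max t 0) A ∈ Icc 0 A :=
  ⟨le_min (le_max_right _ _) hA, min_le_right _ _⟩

theorem truncPow_nonneg (hA : 0 ≤ A) (t : ℝ) : 0 ≤ truncPow q A t :=
  Real.rpow_nonneg (clamp_mem hA t).1 _

theorem truncPow_pos (hA : 0 < A) {t : ℝ} (ht : 0 < t) : 0 < truncPow q A t :=
  Real.rpow_pos_of_pos (lt_min (lt_max_of_lt_left ht) hA) _

theorem truncPow_le (hA : 0 ≤ A) (hq : 0 ≤ q) (t : ℝ) : truncPow q A t ≤ A ^ q :=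
  Real.rpow_le_rpow (clamp_mem hA t).1 (clamp_mem hA t).2 hq

theorem truncPow_le_rpow (hA : 0 ≤ A) (hq : 0 ≤ q) {t : ℝ} (ht : 0 ≤ t) :
    truncPow q A t ≤ t ^ q := by
  refine Real.rpow_le_rpow (clamp_mem hA t).1 ?_ hq
  rw [max_eq_left ht]
  exact min_le_left _ _

theorem monotone_truncPow (hA : 0 ≤ A) (hq : 0 ≤ q) : Monotone (truncPow q A) := fun _ _ h =>
  Real.rpow_le_rpow (clamp_mem hA _).1 (min_le_min_right _ (max_le_max_right _ h)) hq

theorem continuous_truncPow (hq : 0 ≤ q) : Continuous (truncPow q A) :=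
  ((continuous_id.max continuous_const).min continuous_const).rpow_const fun _ => .inr hq

theorem abs_truncPow_sub_le (hA : 0 ≤ A) (hq : 1 ≤ q) (x y : ℝ) :
    |truncPow q A x - truncPow q A y| ≤ q * A ^ (q - 1) * |x - y| := by
  have h1 : ∀ t ∈ Icc 0 A, HasDerivWithinAt (fun t : ℝ => t ^ q) (q * t ^ (q - 1)) (Icc 0 A) t :=
    fun t _ => (Real.hasDerivAt_rpow_const (.inr hq)).hasDerivWithinAt
  have h2 : ∀ t ∈ Icc 0 A, ‖q * t ^ (q - 1)‖ ≤ q * A ^ (q - 1) := fun t ht => by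
    rw [Real.norm_eq_abs, abs_of_nonneg (mul_nonneg (by linarith) (Real.rpow_nonneg ht.1 _))]
    exact mul_le_mul_of_nonneg_left (Real.rpow_le_rpow ht.1 ht.2 (by linarith)) (by linarith)
  have h3 := (convex_Icc 0 A).norm_image_sub_le_of_norm_hasDerivWithin_le h1 h2
    (clamp_mem hA y) (clamp_mem hA x)
  have h4 : |min (max x 0) A - min (max y 0) A| ≤ |x - y| := by
    have := ((LipschitzWith.id.max_const (0 : ℝ)).min_const A).dist_le_mul x y
    simpa [Real.dist_eq] using this
  exact h3.trans (mul_le_mul_of_nonneg_left h4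
    (mul_nonneg (by linarith) (Real.rpow_nonneg hA _)))

end TruncatedPower

/-! ### Small energy forces small height at the pole. -/

section SmallSolutions

variable {w : ℝ → ℝ} {K : ℝ}

/-- A solution of `-Δ u = l g(u)` with `g(t) ≤ t ^ q` and Dirichlet energy at most `E` is small at
the pole: here `q < (d + 3) / (d - 1)` makes the exponent on the left positive. -/
theorem IsRadialWeight.rpow_le_of_energy_le (hw : IsRadialWeight w K) {c d : ℝ} (hc : 0 < c)
    (hd : 1 < d) (hwd : ∀ r, 0 ≤ r → c * r ^ d ≤ w r) {g : ℝ → ℝ} (hg : Continuous g)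
    {q : ℝ} (hq : 0 < q) (hg0 : ∀ x, 0 ≤ g x) (hgq : ∀ x, 0 ≤ x → g x ≤ x ^ q) {R l E : ℝ}
    (hR : 0 < R) (hl : 0 < l) (hE : 0 < E) {u : ℝ → ℝ} (hu : Continuous u) (hu0 : 0 < u 0)
    (huR : ∀ r ∈ Icc 0 R, u r = ∫ s in r..R, l * avgFlux w (fun t => g (u t)) s)
    (hEu : ∫ s in (0 : ℝ)..R, w s * (l * avgFlux w (fun t => g (u t)) s) ^ 2 ≤ E) :
    u 0 ^ (2 - (q - 1) * (d - 1) / 2) ≤ 4 * E * (l * K) ^ ((d - 1) / 2) / (c * (d - 1)) := by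
  have hK := hw.const_pos
  have hcw := hw.continuous
  have hgu : Continuous fun t => g (u t) := hg.comp hu
  set f : ℝ → ℝ := fun s => l * avgFlux w (fun t => g (u t)) s with hf
  have hfc : Continuous f := (hw.continuous_avgFlux hgu).const_mul l
  have hi : ∀ a b, IntervalIntegrable f volume a b := fun a b => hfc.intervalIntegrable a b
  have hf0 : ∀ s, 0 ≤ s → 0 ≤ f s := fun s hs =>
    mul_nonneg hl.le (hw.avgFlux_nonneg hs fun t _ => hg0 _)
  have hEf : ∫ s in (0 : ℝ)..R, w s * f s ^ 2 ≤ E := hEu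
  clear_value f
  have hu_split : ∀ r ∈ Icc 0 R, u r = u 0 - ∫ s in (0 : ℝ)..r, f s := fun r hr => by
    rw [huR r hr, huR 0 (left_mem_Icc.2 hR.le),
      ← intervalIntegral.integral_add_adjacent_intervals (hi 0 r) (hi r R)]
    ring
  have hu_nonneg : ∀ r ∈ Icc 0 R, 0 ≤ u r := fun r hr => by
    rw [huR r hr]
    exact intervalIntegral.integral_nonneg hr.2 fun s hs => hf0 s (hr.1.trans hs.1)
  have hu_le : ∀ r ∈ Icc 0 R, u r ≤ u 0 := fun r hr => by
    rw [hu_split r hr]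
    have := intervalIntegral.integral_nonneg (μ := volume) hr.1 (f := f) fun s hs => hf0 s hs.1
    linarith
  set a := u 0 with ha
  have hlower : ∀ r ∈ Icc 0 R, a - l * K * a ^ q * r ^ 2 / 2 ≤ u r := by
    intro r hr
    rw [hu_split r hr]
    have h1 : ∫ s in (0 : ℝ)..r, f s ≤ ∫ s in (0 : ℝ)..r, l * K * a ^ q * s := by
      refine intervalIntegral.integral_mono_on hr.1 (hi _ _)
        (by apply Continuous.intervalIntegrable; fun_prop) fun s hs => ?_
      have := hw.abs_avgFlux_le (h := fun t => g (u t)) (s := s) (B := a ^ q) fun t ht => by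
        rw [uIoc_of_le hs.1] at ht
        have htR : t ∈ Icc 0 R := ⟨ht.1.le, ht.2.trans (hs.2.trans hr.2)⟩
        rw [abs_of_nonneg (hg0 _)]
        exact (hgq _ (hu_nonneg t htR)).trans
          (Real.rpow_le_rpow (hu_nonneg t htR) (hu_le t htR) hq.le)
      rw [abs_of_nonneg hs.1] at this
      calc f s ≤ l * (K * a ^ q * s) := by
            rw [hf]
            exact mul_le_mul_of_nonneg_left ((le_abs_self _).trans this) hl.le
        _ = _ := by ring
    rw [intervalIntegral.integral_const_mul, integral_id] at h1
    linarith
  have hX : 0 < a ^ (1 - q) / (l * K) := by positivity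
  -- Chosen so that `l * K * a ^ q * r₁ ^ 2 = a`: up to this radius the profile loses at most half
  -- of its height.
  set r₁ := (a ^ (1 - q) / (l * K)) ^ (1 / 2 : ℝ) with hr₁
  have hr₁0 : 0 < r₁ := Real.rpow_pos_of_pos hX _
  have hr₁sq : r₁ ^ 2 = a ^ (1 - q) / (l * K) := by
    rw [hr₁, ← Real.rpow_natCast, ← Real.rpow_mul hX.le]
    norm_num
  have hhalf : ∀ r : ℝ, 0 ≤ r → r ≤ r₁ → a / 2 ≤ a - l * K * a ^ q * r ^ 2 / 2 := by
    intro r h0 h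
    have h1 : r ^ 2 ≤ a ^ (1 - q) / (l * K) := hr₁sq ▸ pow_le_pow_left₀ h0 h 2
    have h2 : l * K * a ^ q * r ^ 2 ≤ l * K * a ^ q * (a ^ (1 - q) / (l * K)) :=
      mul_le_mul_of_nonneg_left h1 (by positivity)
    have h3 : l * K * a ^ q * (a ^ (1 - q) / (l * K)) = a := by
      calc _ = a ^ q * a ^ (1 - q) := by field_simp
        _ = a := by rw [← Real.rpow_add hu0]; simp
    linarith
  have hr₁R : r₁ < R := by
    by_contra! h
    have h1 := hhalf R hR.le h
    have h2 := hlower R (right_mem_Icc.2 hR.le)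
    rw [huR R (right_mem_Icc.2 hR.le), intervalIntegral.integral_same] at h2
    linarith
  have hr₁m : r₁ ∈ Icc 0 R := ⟨hr₁0.le, hr₁R.le⟩
  have hmain : a / 2 ≤ ∫ s in r₁..R, f s := by
    have := (hhalf r₁ hr₁0.le le_rfl).trans (hlower r₁ hr₁m)
    rwa [huR r₁ hr₁m] at this
  set τ := a / (2 * E) with hτ
  have hτ0 : 0 < τ := by positivity
  have hrd : IntervalIntegrable (fun s : ℝ => s ^ (-d)) volume r₁ R :=
    intervalIntegral.intervalIntegrable_rpow (.inr fun h => by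
      rw [uIcc_of_le hr₁R.le] at h
      linarith [h.1])
  have hwf : ∀ a b, IntervalIntegrable (fun s => w s * f s ^ 2) volume a b := fun a b => by
    apply Continuous.intervalIntegrable
    fun_prop
  have hamgm : ∫ s in r₁..R, f s ≤
      ∫ s in r₁..R, (τ / 2 * (w s * f s ^ 2) + 1 / (2 * τ * c) * s ^ (-d)) := by
    refine intervalIntegral.integral_mono_on hr₁R.le (hi _ _)
      (((hwf _ _).const_mul _).add (hrd.const_mul _)) fun s hs => ?_
    have hs0 : 0 < s := hr₁0.trans_le hs.1
    have hsd : 0 < s ^ d := Real.rpow_pos_of_pos hs0 _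
    have h1 := hwd s hs0.le
    have h2 : τ / 2 * (c * s ^ d * f s ^ 2) ≤ τ / 2 * (w s * f s ^ 2) := by gcongr
    have h3 : f s ≤ τ / 2 * (c * s ^ d * f s ^ 2) + 1 / (2 * τ * c) * s ^ (-d) := by
      rw [Real.rpow_neg hs0.le]
      have : τ / 2 * (c * s ^ d * f s ^ 2) + 1 / (2 * τ * c) * (s ^ d)⁻¹ - f s =
          (τ * c * s ^ d * f s - 1) ^ 2 / (2 * τ * c * s ^ d) := by
        field_simp
        ring
      have h4 : 0 ≤ (τ * c * s ^ d * f s - 1) ^ 2 / (2 * τ * c * s ^ d) := by positivity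
      linarith
    linarith
  rw [intervalIntegral.integral_add ((hwf _ _).const_mul _) (hrd.const_mul _),
    intervalIntegral.integral_const_mul, intervalIntegral.integral_const_mul] at hamgm
  have hE' : ∫ s in r₁..R, w s * f s ^ 2 ≤ E := by
    refine le_trans ?_ hEf
    rw [← intervalIntegral.integral_add_adjacent_intervals (hwf 0 r₁) (hwf r₁ R)]
    have : 0 ≤ ∫ s in (0 : ℝ)..r₁, w s * f s ^ 2 :=
      intervalIntegral.integral_nonneg hr₁0.le fun s _ => mul_nonneg (hw.nonneg s) (sq_nonneg _)
    linarith
  -- Since `d > 1`, the tail of `s ^ (-d)` is integrable at infinity, so the bound does not depend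
  -- on `R`.
  have htail : ∫ s in r₁..R, s ^ (-d) ≤ r₁ ^ (1 - d) / (d - 1) := by
    rw [integral_rpow (.inr ⟨by linarith, fun h => by
      rw [uIcc_of_le hr₁R.le] at h
      linarith [h.1]⟩), show -d + 1 = 1 - d by ring]
    have : 0 ≤ R ^ (1 - d) := Real.rpow_nonneg hR.le _
    rw [← neg_div_neg_eq, neg_sub, neg_sub]
    exact div_le_div_of_nonneg_right (by linarith) (by linarith)
  have hfin : a / 2 ≤ τ / 2 * E + 1 / (2 * τ * c) * (r₁ ^ (1 - d) / (d - 1)) := by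
    refine hmain.trans (hamgm.trans (add_le_add ?_ ?_)) <;> gcongr
  have hd' : 0 < d - 1 := by linarith
  have hfin' : a ^ 2 ≤ 4 * E * r₁ ^ (1 - d) / (c * (d - 1)) := by
    have e1 : τ / 2 * E = a / 4 := by rw [hτ]; field_simp; norm_num
    have e2 : 1 / (2 * τ * c) * (r₁ ^ (1 - d) / (d - 1)) =
        E * r₁ ^ (1 - d) / (c * (d - 1)) / a := by
      rw [hτ]; field_simp
    rw [e1, e2] at hfin
    have h1 : a / 4 ≤ E * r₁ ^ (1 - d) / (c * (d - 1)) / a := by linarith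
    rw [le_div_iff₀ hu0] at h1
    calc a ^ 2 = 4 * (a / 4 * a) := by ring
      _ ≤ 4 * (E * r₁ ^ (1 - d) / (c * (d - 1))) := by linarith
      _ = _ := by ring
  have hr₁d : r₁ ^ (1 - d) = (l * K) ^ ((d - 1) / 2) * a ^ ((q - 1) * (d - 1) / 2) := by
    rw [hr₁, ← Real.rpow_mul hX.le, Real.div_rpow (by positivity) (by positivity),
      ← Real.rpow_mul hu0.le, div_eq_mul_inv, ← Real.rpow_neg (by positivity), mul_comm]
    congr 2 <;> ring
  rw [Real.rpow_sub hu0, div_le_iff₀ (Real.rpow_pos_of_pos hu0 _), Real.rpow_two]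
  rw [hr₁d] at hfin'
  refine hfin'.trans (le_of_eq (by ring))

end SmallSolutions

/-! ### Existence of Dirichlet profiles of small height. -/

section SmallSolutions

variable {w : ℝ → ℝ} {K : ℝ}

theorem IsRadialWeight.integral_nonneg_mul (hw : IsRadialWeight w K) {h : ℝ → ℝ} {a b : ℝ}
    (hab : a ≤ b) (hh : ∀ t ∈ Icc a b, 0 ≤ h t) : 0 ≤ ∫ t in a..b, w t * h t :=
  intervalIntegral.integral_nonneg hab fun t ht => mul_nonneg (hw.nonneg t) (hh t ht)

theorem IsRadialWeight.le_integral_of_rpow_le (hw : IsRadialWeight w K) {c d : ℝ} (hd : 1 < d)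
    (hwd : ∀ r, 0 ≤ r → c * r ^ d ≤ w r) {R : ℝ} (hR : 0 ≤ R) :
    c * R ^ (d + 1) / (d + 1) ≤ ∫ t in (0 : ℝ)..R, w t := by
  have h := intervalIntegral.integral_mono_on (μ := volume) hR
    (f := fun r => c * r ^ d) (g := w)
    ((intervalIntegral.intervalIntegrable_rpow' (by linarith)).const_mul c)
    (hw.continuous.intervalIntegrable _ _) fun r hr => hwd r hr.1
  rw [intervalIntegral.integral_const_mul, integral_rpow (.inl (by linarith)),
    Real.zero_rpow (by linarith), sub_zero] at h
  rwa [mul_div_assoc]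

/-- The mass of the potential of an affine function of height `b ≤ 1` on `[0, R]`. -/
theorem IsRadialWeight.le_integral_primitive_truncPow (hw : IsRadialWeight w K) {c d : ℝ}
    (hd : 1 < d) (hwd : ∀ r, 0 ≤ r → c * r ^ d ≤ w r) {q : ℝ} (hq : 0 < q) {R b : ℝ}
    (hR : 0 < R) (hb : 0 < b) (hb1 : b ≤ 1) :
    (b / 4) ^ (q + 1) * (c * (R / 2) ^ (d + 1) / (d + 1)) ≤
      ∫ s in (0 : ℝ)..R, w s * ∫ t in (0 : ℝ)..b / R * (R - s), truncPow q 1 t := by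
  have hgc : Continuous (truncPow q 1) := continuous_truncPow hq.le
  have hgm : Monotone (truncPow q 1) := monotone_truncPow zero_le_one hq.le
  have hG0 : ∀ x, 0 ≤ x → 0 ≤ ∫ t in (0 : ℝ)..x, truncPow q 1 t := fun x hx =>
    intervalIntegral.integral_nonneg hx fun t _ => truncPow_nonneg zero_le_one t
  have hGb : ∀ x, b / 2 ≤ x → (b / 4) ^ (q + 1) ≤ ∫ t in (0 : ℝ)..x, truncPow q 1 t := by
    intro x hx
    -- The tangent at `b / 4` already yields `(b / 4) ^ q * (x - b / 4)`, and `x - b / 4 ≥ b / 4`.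
    -- The affine function is at least `b / 2` on the inner half of the interval.
    have h1 := primitive_tangent_le hgc hgm (b / 4) x
    rw [truncPow_of_mem ⟨by linarith, by linarith⟩] at h1
    have h2 : (b / 4) ^ q * (b / 4) ≤ (b / 4) ^ q * (x - b / 4) := by
      gcongr
      linarith
    rw [Real.rpow_add (by linarith), Real.rpow_one]
    linarith [hG0 (b / 4) (by linarith)]
  have hGc : Continuous fun s => ∫ t in (0 : ℝ)..b / R * (R - s), truncPow q 1 t :=
    (continuous_primitive_of_continuous hgc).comp (by fun_prop)
  have hi : ∀ x y, IntervalIntegrable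
      (fun s => w s * ∫ t in (0 : ℝ)..b / R * (R - s), truncPow q 1 t) volume x y :=
    fun x y => hw.intervalIntegrable hGc x y
  rw [← intervalIntegral.integral_add_adjacent_intervals (hi 0 (R / 2)) (hi (R / 2) R)]
  have h2 : 0 ≤ ∫ s in R / 2..R, w s * ∫ t in (0 : ℝ)..b / R * (R - s), truncPow q 1 t :=
    hw.integral_nonneg_mul (by linarith) fun s hs =>
      hG0 _ (mul_nonneg (by positivity) (by linarith [hs.2]))
  have h3 : ∫ s in (0 : ℝ)..R / 2, (b / 4) ^ (q + 1) * w s ≤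
      ∫ s in (0 : ℝ)..R / 2, w s * ∫ t in (0 : ℝ)..b / R * (R - s), truncPow q 1 t := by
    refine intervalIntegral.integral_mono_on (by linarith)
      ((hw.continuous.const_mul _).intervalIntegrable _ _) (hi _ _) fun s hs => ?_
    rw [mul_comm]
    refine mul_le_mul_of_nonneg_left (hGb _ ?_) (hw.nonneg s)
    calc b / 2 = b / R * (R / 2) := by field_simp
      _ ≤ b / R * (R - s) := by
        gcongr
        linarith [hs.2]
  rw [intervalIntegral.integral_const_mul] at h3
  have h4 := mul_le_mul_of_nonneg_left (hw.le_integral_of_rpow_le hd hwd (R := R / 2)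
    (by linarith)) (show 0 ≤ (b / 4) ^ (q + 1) by positivity)
  linarith

theorem profile_antitone {g v : ℝ → ℝ} {a T : ℝ} (hw : IsRadialWeight w K) (hg : Continuous g)
    (hg0 : ∀ x, 0 ≤ g x) (hv : Continuous v) (hvT : IsProfile w g a T v) {r s : ℝ} (hr : 0 ≤ r)
    (hrs : r ≤ s) (hs : s ≤ T) : v s ≤ v r := by
  have hgv : Continuous fun t => g (v t) := hg.comp hv
  have hi : ∀ a b, IntervalIntegrable (avgFlux w fun t => g (v t)) volume a b := fun a b =>
    (hw.continuous_avgFlux hgv).intervalIntegrable a b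
  rw [hvT s ⟨hr.trans hrs, hs⟩, hvT r ⟨hr, hrs.trans hs⟩,
    ← intervalIntegral.integral_add_adjacent_intervals (hi 0 r) (hi r s)]
  have : 0 ≤ ∫ x in r..s, avgFlux w (fun t => g (v t)) x :=
    intervalIntegral.integral_nonneg hrs fun x hx =>
      hw.avgFlux_nonneg (hr.trans hx.1) fun t _ => hg0 _
  linarith

theorem profile_strictAnti {g v : ℝ → ℝ} {a T : ℝ} (hw : IsRadialWeight w K) (hg : Continuous g)
    (hg0 : ∀ x, 0 ≤ g x) (hga : 0 < g a) (hv : Continuous v) (hvT : IsProfile w g a T v) {r s : ℝ}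
    (hr : 0 ≤ r) (hrs : r < s) (hs : s ≤ T) : v s < v r := by
  have hgv : Continuous fun t => g (v t) := hg.comp hv
  have hv0 : v 0 = a := by simpa using hvT 0 ⟨le_rfl, hr.trans (hrs.le.trans hs)⟩
  have hi : ∀ a b, IntervalIntegrable (avgFlux w fun t => g (v t)) volume a b := fun a b =>
    (hw.continuous_avgFlux hgv).intervalIntegrable a b
  rw [hvT s ⟨hr.trans hrs.le, hs⟩, hvT r ⟨hr, hrs.le.trans hs⟩,
    ← intervalIntegral.integral_add_adjacent_intervals (hi 0 r) (hi r s)]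
  have : 0 < ∫ x in r..s, avgFlux w (fun t => g (v t)) x :=
    intervalIntegral.intervalIntegral_pos_of_pos_on (hi r s) (fun x hx =>
      hw.avgFlux_pos (hr.trans_lt hx.1) hgv (fun t _ => hg0 _) (by rwa [hv0])) hrs
  linarith

/-- For subcritical `q` there are Dirichlet solutions with arbitrarily small value at the pole. -/
theorem IsRadialWeight.exists_small_dirichlet_profile (hw : IsRadialWeight w K) {c C d : ℝ}
    (hc : 0 < c) (hd : 1 < d) (hwd : ∀ r, 0 ≤ r → c * r ^ d ≤ w r)
    (hwC : ∀ R, 1 ≤ R → ∫ t in (0 : ℝ)..R, w t ≤ C * R ^ (d + 1)) {q : ℝ} (hq1 : 1 < q)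
    (hq : (q - 1) * (d - 1) < 4) {ε : ℝ} (hε : 0 < ε) :
    ∃ (R a : ℝ) (u : ℝ → ℝ), 0 < R ∧ 0 < a ∧ a < ε ∧ Continuous u ∧ u R = 0 ∧
      (∀ r ∈ Icc 0 R, u r ∈ Icc 0 a) ∧ IsProfile w (fun t => t ^ q) a R u := by
  have hK := hw.const_pos
  have hq0 : 0 < q := by linarith
  have hq1' : 0 < q - 1 := by linarith
  have hd1 : 0 < d - 1 := by linarith
  have hC : 0 < C := by
    have h1 := hw.le_integral_of_rpow_le hd hwd zero_le_one
    have h2 := hwC 1 le_rfl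
    rw [Real.one_rpow] at h1 h2
    have : 0 < c * 1 / (d + 1) := by positivity
    linarith
  -- the bound on the multiplier, and the exponents
  set Λ : ℝ := C * 4 ^ (q + 1) * 2 ^ (d + 1) * (d + 1) / c with hΛ
  have hΛ0 : 0 < Λ := by positivity
  set θ : ℝ := 2 - (q - 1) * (d - 1) / 2 with hθ
  have hθ0 : 0 < θ := by rw [hθ]; linarith
  set η : ℝ := 4 / (q - 1) - (d - 1) with hη
  have hη0 : 0 < η := by
    rw [hη, sub_pos, lt_div_iff₀ hq1']
    linarith
  -- The entry `1` keeps `u` in the range where the truncation is inactive; the other entry leaves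
  -- room for the rescaling factor, at most `Λ ^ (1 / (q - 1))`.
  set ε' : ℝ := min 1 (ε / (2 * Λ ^ (1 / (q - 1)))) with hε'
  have hε'0 : 0 < ε' := lt_min one_pos (by positivity)
  set D : ℝ := 4 * C * (Λ * K) ^ ((d - 1) / 2) / (c * (d - 1)) with hD
  obtain ⟨R, hR1, hRε⟩ : ∃ R : ℝ, 1 ≤ R ∧ D * R ^ (-η) ≤ ε' ^ θ := by
    have h1 : Tendsto (fun R : ℝ => D * R ^ (-η)) atTop (𝓝 (D * 0)) :=
      (tendsto_rpow_neg_atTop hη0).const_mul D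
    rw [mul_zero] at h1
    have h2 : ∀ᶠ R : ℝ in atTop, D * R ^ (-η) < ε' ^ θ :=
      h1.eventually (gt_mem_nhds (Real.rpow_pos_of_pos hε'0 θ))
    obtain ⟨R, hR, hR'⟩ := (h2.and (eventually_ge_atTop 1)).exists
    exact ⟨R, hR', hR.le⟩
  have hR : 0 < R := by linarith
  -- The natural scaling `b ^ (q - 1) * R ^ 2 = 1`: the constraint `ρ ^ 2 ≲ b ^ 2 R ^ (d - 1)` and
  -- the mass `m ∼ b ^ (q + 1) R ^ (d + 1)` then have a ratio bounded independently of `R`, while `ρ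
  -- ^ 2 ≲ R ^ (-η)` tends to zero.
  set b : ℝ := R ^ (-(2 / (q - 1))) with hb
  have hb0 : 0 < b := Real.rpow_pos_of_pos hR _
  have hb1 : b ≤ 1 := Real.rpow_le_one_of_one_le_of_nonpos hR1 (by
    have : 0 < 2 / (q - 1) := by positivity
    linarith)
  have hbq : b ^ (q - 1) * R ^ 2 = 1 := by
    rw [hb, ← Real.rpow_mul hR.le, ← Real.rpow_two, ← Real.rpow_add hR]
    rw [show -(2 / (q - 1)) * (q - 1) + 2 = 0 by field_simp; ring, Real.rpow_zero]
  set W := ∫ t in (0 : ℝ)..R, w t with hW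
  have hWC : W ≤ C * R ^ (d + 1) := hwC R hR1
  have hW0 : 0 < W := by
    refine lt_of_lt_of_le ?_ (hw.le_integral_of_rpow_le hd hwd hR.le)
    positivity
  set ρ : ℝ := √((b / R) ^ 2 * W) with hρ
  have hρsq : ρ ^ 2 = (b / R) ^ 2 * W := Real.sq_sqrt (by positivity)
  have hρ0 : 0 < ρ := Real.sqrt_pos.2 (by positivity)
  set m : ℝ := (b / 4) ^ (q + 1) * (c * (R / 2) ^ (d + 1) / (d + 1)) with hm
  have hm0 : 0 < m := by positivity
  obtain ⟨u, l, huc, hl, hlm, hu, huE⟩ := hw.exists_multiplier_solution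
    (continuous_truncPow hq0.le) (monotone_truncPow zero_le_one hq0.le)
    (truncPow_nonneg (q := q) zero_le_one) (truncPow_le zero_le_one hq0.le) hR hρ0 hb0
    (by rw [hρsq, intervalIntegral.integral_mul_const, mul_comm]) hm0
    (hw.le_integral_primitive_truncPow hd hwd hq0 hR hb0 hb1)
  have hgu : Continuous fun t => truncPow q 1 (u t) := (continuous_truncPow hq0.le).comp huc
  have hk := hw.continuous_avgFlux hgu
  have hk0 : ∀ s, 0 ≤ s → 0 ≤ avgFlux w (fun t => truncPow q 1 (u t)) s := fun s hs =>
    hw.avgFlux_nonneg hs fun t _ => truncPow_nonneg zero_le_one _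
  -- bounds on `l` and `ρ`
  have hρC : ρ ^ 2 ≤ C * R ^ (-η) := by
    have e : b ^ 2 * R ^ (d - 1) = R ^ (-η) := by
      rw [hb, ← Real.rpow_natCast (R ^ _), ← Real.rpow_mul hR.le, ← Real.rpow_add hR]
      congr 1
      rw [hη]
      push_cast
      ring
    calc ρ ^ 2 ≤ (b / R) ^ 2 * (C * R ^ (d + 1)) := by rw [hρsq]; gcongr
      _ = C * (b ^ 2 * R ^ (d - 1)) := by
        rw [show d + 1 = d - 1 + 2 by ring, Real.rpow_add hR, Real.rpow_two]
        field_simp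
      _ = _ := by rw [e]
  have hlΛ : l ≤ Λ := by
    have h1 : l ≤ ρ ^ 2 / m := (le_div_iff₀ hm0).2 hlm
    refine h1.trans ((div_le_iff₀ hm0).2 ?_)
    have e1 : Λ * m = C * R ^ (d + 1) * b ^ (q + 1) := by
      rw [hΛ, hm, Real.div_rpow hb0.le (by norm_num), Real.div_rpow hR.le (by norm_num)]
      field_simp
    have e2 : b ^ (q + 1) * R ^ 2 = b ^ 2 := by
      rw [show q + 1 = q - 1 + 2 by ring, Real.rpow_add hb0, Real.rpow_two, mul_right_comm, hbq,
        one_mul]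
    calc ρ ^ 2 ≤ (b / R) ^ 2 * (C * R ^ (d + 1)) := by rw [hρsq]; gcongr
      _ = (b ^ (q + 1) * R ^ 2) / R ^ 2 * (C * R ^ (d + 1)) := by rw [e2, div_pow]
      _ = C * R ^ (d + 1) * b ^ (q + 1) := by field_simp
      _ = Λ * m := e1.symm
  -- positivity and monotonicity of `u`
  have hi : ∀ x y, IntervalIntegrable
      (fun s => l * avgFlux w (fun t => truncPow q 1 (u t)) s) volume x y := fun x y =>
    (hk.const_mul l).intervalIntegrable x y
  have hu_nonneg : ∀ r ∈ Icc 0 R, 0 ≤ u r := fun r hr => by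
    rw [hu r hr]
    exact intervalIntegral.integral_nonneg hr.2 fun s hs =>
      mul_nonneg hl.le (hk0 s (hr.1.trans hs.1))
  have hu_split : ∀ r ∈ Icc 0 R,
      u 0 = (∫ s in (0 : ℝ)..r, l * avgFlux w (fun t => truncPow q 1 (u t)) s) + u r :=
    fun r hr => by
      rw [hu r hr, hu 0 (left_mem_Icc.2 hR.le),
        intervalIntegral.integral_add_adjacent_intervals (hi 0 r) (hi r R)]
  have hu_le : ∀ r ∈ Icc 0 R, u r ≤ u 0 := fun r hr => by
    have := intervalIntegral.integral_nonneg (μ := volume) hr.1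
      (f := fun s => l * avgFlux w (fun t => truncPow q 1 (u t)) s)
      fun s hs => mul_nonneg hl.le (hk0 s hs.1)
    linarith [hu_split r hr]
  -- If the height were zero, then `u`, its flux and its energy would vanish, but the energy equals
  -- `ρ ^ 2 > 0`.
  have hu0 : 0 < u 0 := by
    refine (hu_nonneg 0 (left_mem_Icc.2 hR.le)).lt_of_ne fun h0 => ?_
    have hz : ∀ s ∈ Icc 0 R, avgFlux w (fun t => truncPow q 1 (u t)) s = 0 := fun s hs => by
      rw [avgFlux_congr (h₂ := fun _ => 0) fun t ht => ?_]
      · simp [avgFlux]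
      · rw [uIoc_of_le hs.1] at ht
        have htR : t ∈ Icc 0 R := ⟨ht.1.le, ht.2.trans hs.2⟩
        rw [le_antisymm ((hu_le t htR).trans h0.symm.le) (hu_nonneg t htR),
          truncPow_of_mem ⟨le_rfl, zero_le_one⟩, Real.zero_rpow hq0.ne']
    rw [intervalIntegral.integral_congr (g := fun _ => 0) fun s hs => ?_] at huE
    · simp only [intervalIntegral.integral_zero] at huE
      exact absurd huE (pow_pos hρ0 2).ne
    · rw [uIcc_of_le hR.le] at hs
      simp only [hz s hs, mul_zero, ne_eq, OfNat.ofNat_ne_zero, not_false_eq_true, zero_pow]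
  have hsmall : u 0 ≤ ε' := by
    have h1 := hw.rpow_le_of_energy_le hc hd hwd (continuous_truncPow hq0.le) hq0
      (truncPow_nonneg (q := q) zero_le_one)
      (fun x hx => truncPow_le_rpow zero_le_one hq0.le hx) hR hl (pow_pos hρ0 2) huc hu0 hu huE.le
    have h2 : 4 * ρ ^ 2 * (l * K) ^ ((d - 1) / 2) / (c * (d - 1)) ≤ D * R ^ (-η) := by
      calc _ ≤ 4 * (C * R ^ (-η)) * (Λ * K) ^ ((d - 1) / 2) / (c * (d - 1)) := by gcongr
        _ = _ := by rw [hD]; ring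
    exact (Real.rpow_le_rpow_iff hu0.le hε'0.le hθ0).1 (h1.trans (h2.trans hRε))
  have hu1 : ∀ r ∈ Icc 0 R, u r ∈ Icc 0 1 := fun r hr =>
    ⟨hu_nonneg r hr, (hu_le r hr).trans (hsmall.trans (min_le_left _ _))⟩
  -- removal of the multiplier by scaling
  set κ : ℝ := l ^ (1 / (q - 1)) with hκ
  have hκ0 : 0 < κ := Real.rpow_pos_of_pos hl _
  have hκq : κ ^ q = κ * l := by
    have : κ ^ (q - 1) = l := by
      rw [hκ, ← Real.rpow_mul hl.le, one_div_mul_cancel hq1'.ne', Real.rpow_one]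
    calc κ ^ q = κ ^ (1 + (q - 1)) := by ring_nf
      _ = _ := by rw [Real.rpow_add hκ0, Real.rpow_one, this]
  refine ⟨R, κ * u 0, fun r => κ * u r, hR, mul_pos hκ0 hu0, ?_, huc.const_mul κ, ?_,
    fun r hr => ⟨mul_nonneg hκ0.le (hu_nonneg r hr),
      mul_le_mul_of_nonneg_left (hu_le r hr) hκ0.le⟩, fun r hr => ?_⟩
  · have h1 : κ ≤ Λ ^ (1 / (q - 1)) := Real.rpow_le_rpow hl.le hlΛ (by positivity)
    calc κ * u 0 ≤ Λ ^ (1 / (q - 1)) * (ε / (2 * Λ ^ (1 / (q - 1)))) :=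
          mul_le_mul h1 (hsmall.trans (min_le_right _ _)) hu0.le (by positivity)
      _ = ε / 2 := by field_simp
      _ < ε := by linarith
  · change κ * u R = 0
    rw [hu R (right_mem_Icc.2 hR.le), intervalIntegral.integral_same, mul_zero]
  · rw [hu_split r hr, mul_add, ← intervalIntegral.integral_const_mul]
    have : ∫ s in (0 : ℝ)..r, avgFlux w (fun t => (κ * u t) ^ q) s =
        ∫ s in (0 : ℝ)..r, κ * (l * avgFlux w (fun t => truncPow q 1 (u t)) s) := by
      refine intervalIntegral.integral_congr fun s hs => ?_
      rw [uIcc_of_le hr.1] at hs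
      rw [← mul_assoc, ← avgFlux_const_mul]
      refine avgFlux_congr fun t ht => ?_
      rw [uIoc_of_le hs.1] at ht
      have htR : t ∈ Icc 0 R := ⟨ht.1.le, ht.2.trans (hs.2.trans hr.2)⟩
      rw [truncPow_of_mem (hu1 t htR), Real.mul_rpow hκ0.le (hu_nonneg t htR), hκq]
    rw [this]
    ring

end SmallSolutions

/-! ### Shooting in the height at the pole. -/

section Shooting

variable {w : ℝ → ℝ} {K : ℝ}

theorem IsProfile.rpow_truncPow {q a T : ℝ} {v : ℝ → ℝ}
    (hv : IsProfile w (fun t => t ^ q) a T v) {A : ℝ} (hA : ∀ r ∈ Icc 0 T, v r ∈ Icc 0 A) :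
    IsProfile w (truncPow q A) a T v := by
  intro r hr
  rw [hv r hr]
  congr 1
  refine intervalIntegral.integral_congr fun s hs => ?_
  rw [uIcc_of_le hr.1] at hs
  refine avgFlux_congr fun t ht => ?_
  rw [uIoc_of_le hs.1] at ht
  rw [truncPow_of_mem (hA t ⟨ht.1.le, ht.2.trans (hs.2.trans hr.2)⟩)]

/-- A positive global profile and Dirichlet profiles with small value at the pole force two
distinct Dirichlet profiles on a common interval. -/
theorem IsRadialWeight.exists_two_dirichlet_profiles (hw : IsRadialWeight w K) {q : ℝ}
    (hq : 1 < q)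
    (hsmall : ∀ ε > 0, ∃ (R a : ℝ) (u : ℝ → ℝ), 0 < R ∧ 0 < a ∧ a < ε ∧ Continuous u ∧ u R = 0 ∧
      (∀ r ∈ Icc 0 R, u r ∈ Icc 0 a) ∧ IsProfile w (fun t => t ^ q) a R u)
    {v₀ : ℝ → ℝ} (hv₀c : Continuous v₀) (hv₀ : ∀ r, 0 ≤ r → 0 < v₀ r)
    (hv₀T : ∀ T, IsProfile w (fun t => t ^ q) (v₀ 0) T v₀) :
    ∃ T A a₁ a₂ : ℝ, 0 < T ∧ 0 < A ∧ a₁ ≠ a₂ ∧ ∀ a, a = a₁ ∨ a = a₂ →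
      ∃ v : ℝ → ℝ, Continuous v ∧
        (∀ r, v r = a - ∫ s in (0 : ℝ)..r, avgFlux w (fun t => truncPow q A (v t)) s) ∧
        v 0 = a ∧ v T = 0 ∧ (∀ r ∈ Ico 0 T, 0 < v r) ∧ ∀ r ∈ Icc 0 T, v r ≤ A := by
  have hK := hw.const_pos
  have hq0 : 0 < q := by linarith
  set A := v₀ 0 with hA
  have hA0 : 0 < A := hv₀ 0 le_rfl
  have hgc : Continuous (truncPow q A) := continuous_truncPow hq0.le
  have hg0 : ∀ x, 0 ≤ truncPow q A x := truncPow_nonneg hA0.le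
  have hΛ : 0 < q * A ^ (q - 1) := by positivity
  have hlip := abs_truncPow_sub_le hA0.le hq.le
  choose V hVc hV using fun a => hw.exists_profile hΛ hgc hlip (B := A ^ q)
    (fun x => by rw [abs_of_nonneg (hg0 x)]; exact truncPow_le hA0.le hq0.le x) a
  have hVp : ∀ a T, IsProfile w (truncPow q A) a T (V a) := fun a T r _ => hV a r
  have hV0 : ∀ a, V a 0 = a := fun a => by simpa using hV a 0
  have hVa : ∀ T, 0 ≤ T → Continuous fun a => V a T := by
    intro T hT
    refine LipschitzWith.continuous (K := (2 * Real.exp (K * (q * A ^ (q - 1)) * T ^ 2)).toNNReal)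
      (LipschitzWith.of_dist_le_mul fun a b => ?_)
    have := hw.profile_sub_le hΛ hgc hlip (hVc a) (hVc b) (hVp a T) (hVp b T) (right_mem_Icc.2 hT)
    rw [Real.dist_eq, Real.dist_eq]
    refine this.trans (le_of_eq ?_)
    rw [Real.coe_toNNReal _ (by positivity)]
    ring
  have huniq : ∀ a T, ∀ v : ℝ → ℝ, Continuous v → IsProfile w (truncPow q A) a T v →
      ∀ r ∈ Icc 0 T, V a r = v r := by
    intro a T v hvc hv r hr
    have := hw.profile_sub_le hΛ hgc hlip (hVc a) hvc (hVp a T) hv hr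
    rw [sub_self, abs_zero, mul_zero, zero_mul] at this
    exact sub_eq_zero.1 (abs_nonpos_iff.1 this)
  have hanti : ∀ a, 0 < a → ∀ r s, 0 ≤ r → r < s → V a s < V a r := fun a ha r s hr hrs =>
    profile_strictAnti hw hgc hg0 (truncPow_pos hA0 ha) (hVc a) (hVp a s) hr hrs le_rfl
  have hle : ∀ a, ∀ r, 0 ≤ r → V a r ≤ a := fun a r hr => by
    have := profile_antitone hw hgc hg0 (hVc a) (hVp a r) le_rfl hr le_rfl
    rwa [hV0] at this
  obtain ⟨R, a', u, hR, ha'0, ha'A, huc, huR, huI, hup⟩ := hsmall A hA0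
  have ha'R : V a' R = 0 := by
    rw [huniq a' R u huc (hup.rpow_truncPow fun r hr =>
      ⟨(huI r hr).1, (huI r hr).2.trans ha'A.le⟩) R (right_mem_Icc.2 hR.le), huR]
  -- Beyond its zero `R` the profile of height `a'` is strictly negative, which leaves a sign change
  -- on either side of `a'`.
  set T := R + 1 with hT
  have hT0 : 0 < T := by linarith
  have ha'T : V a' T < 0 := by
    have := hanti a' ha'0 R T hR.le (by linarith)
    linarith
  have hv₀A : ∀ r ∈ Icc 0 T, v₀ r ∈ Icc 0 A := by
    intro r hr
    refine ⟨(hv₀ r hr.1).le, ?_⟩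
    rw [hv₀T r r (right_mem_Icc.2 hr.1)]
    have : 0 ≤ ∫ s in (0 : ℝ)..r, avgFlux w (fun t => v₀ t ^ q) s :=
      intervalIntegral.integral_nonneg hr.1 fun s hs =>
        hw.avgFlux_nonneg hs.1 fun t ht => Real.rpow_nonneg (hv₀ t ht.1).le _
    linarith
  have hAT : 0 < V A T := by
    rw [huniq A T v₀ hv₀c ((hv₀T T).rpow_truncPow hv₀A) T (right_mem_Icc.2 hT0.le)]
    exact hv₀ T hT0.le
  -- tiny data stay positive up to `T`
  obtain ⟨δ, hδ0, hδa', hδT⟩ : ∃ δ, 0 < δ ∧ δ < a' ∧ 0 < V δ T := by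
    -- The loss of height up to `T` is of order `δ ^ q`, negligible against `δ` because `q > 1`.
    have hlow : ∀ δ, 0 ≤ δ → δ ≤ A → δ - K * δ ^ q * T * T ≤ V δ T := by
      intro δ hδ hδA
      rw [hV δ T]
      have h1 : |∫ s in (0 : ℝ)..T, avgFlux w (fun t => truncPow q A (V δ t)) s| ≤
          K * δ ^ q * T * |T - 0| := by
        rw [← Real.norm_eq_abs]
        refine intervalIntegral.norm_integral_le_of_norm_le_const fun s hs => ?_
        rw [uIoc_of_le hT0.le] at hs
        refine (hw.abs_avgFlux_le (B := δ ^ q) fun t ht => ?_).trans ?_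
        · rw [uIoc_of_le hs.1.le] at ht
          rw [abs_of_nonneg (hg0 _), ← truncPow_of_mem (A := A) ⟨hδ, hδA⟩]
          exact monotone_truncPow hA0.le hq0.le (hle δ t ht.1.le)
        · rw [abs_of_pos hs.1]
          have : 0 ≤ δ ^ q := Real.rpow_nonneg hδ _
          exact mul_le_mul_of_nonneg_left hs.2 (by positivity)
      rw [sub_zero, abs_of_pos hT0] at h1
      linarith [le_abs_self (∫ s in (0 : ℝ)..T, avgFlux w (fun t => truncPow q A (V δ t)) s)]
    have hlim : Tendsto (fun δ : ℝ => K * T * T * δ ^ (q - 1)) (𝓝[>] 0) (𝓝 0) := by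
      have h1 : Continuous fun δ : ℝ => K * T * T * δ ^ (q - 1) :=
        continuous_const.mul (continuous_id.rpow_const fun _ => .inr (by linarith))
      have h2 := h1.tendsto 0
      rw [Real.zero_rpow (by linarith), mul_zero] at h2
      exact h2.mono_left nhdsWithin_le_nhds
    obtain ⟨δ, h1, h2⟩ := ((hlim.eventually (gt_mem_nhds one_pos)).and
      (Ioo_mem_nhdsGT ha'0)).exists
    refine ⟨δ, h2.1, h2.2, lt_of_lt_of_le ?_ (hlow δ h2.1.le (h2.2.trans ha'A).le)⟩
    have e : δ ^ q = δ ^ (q - 1) * δ := by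
      conv_rhs => rw [← Real.rpow_add_one h2.1.ne', sub_add_cancel]
    rw [e]
    nlinarith [h2.1]
  obtain ⟨a₁, ha₁, ha₁T⟩ : ∃ a ∈ Ioo δ a', V a T = 0 :=
    intermediate_value_Ioo' hδa'.le (hVa T hT0.le).continuousOn ⟨ha'T, hδT⟩
  obtain ⟨a₂, ha₂, ha₂T⟩ : ∃ a ∈ Ioo a' A, V a T = 0 :=
    intermediate_value_Ioo ha'A.le (hVa T hT0.le).continuousOn ⟨ha'T, hAT⟩
  refine ⟨T, A, a₁, a₂, hT0, hA0, (ha₁.2.trans ha₂.1).ne, fun a ha => ?_⟩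
  have hprops : 0 < a ∧ a ≤ A ∧ V a T = 0 := by
    rcases ha with rfl | rfl
    · exact ⟨hδ0.trans ha₁.1, (ha₁.2.trans ha'A).le, ha₁T⟩
    · exact ⟨ha'0.trans ha₂.1, ha₂.2.le, ha₂T⟩
  refine ⟨V a, hVc a, hV a, hV0 a, hprops.2.2, fun r hr => ?_, fun r hr =>
    (hle a r hr.1).trans hprops.2.1⟩
  rw [← hprops.2.2]
  exact hanti a hprops.1 r T hr.1 hr.2

end Shooting

/-! ### Growth of the model weight. -/

section ModelWeight

variable {ψ : ℝ → ℝ}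

theorem IsModelFunction.hasDerivAt (hψ : IsModelFunction ψ) {r : ℝ} (hr : 0 < r) :
    HasDerivAt ψ (derivWithin ψ (Ici 0) r) r :=
  ((hψ.smooth.differentiableOn (by simp) r hr.le).hasDerivWithinAt).hasDerivAt (Ici_mem_nhds hr)

theorem IsModelFunction.continuousOn_deriv (hψ : IsModelFunction ψ) :
    ContinuousOn (derivWithin ψ (Ici 0)) (Ici 0) :=
  hψ.smooth.continuousOn_derivWithin (uniqueDiffOn_Ici 0) (by simp)

theorem IsModelFunction.nonneg (hψ : IsModelFunction ψ) {r : ℝ} (hr : 0 ≤ r) : 0 ≤ ψ r := by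
  rcases hr.eq_or_lt with rfl | h
  · exact hψ.zero.ge
  · exact (hψ.pos r h).le

theorem IsModelFunction.tendsto_div (hψ : IsModelFunction ψ) :
    Tendsto (fun r => ψ r / r) (𝓝[>] 0) (𝓝 1) := by
  have h1 : HasDerivWithinAt ψ 1 (Ici 0) 0 := by
    rw [← hψ.deriv_zero]
    exact (hψ.smooth.differentiableOn (by simp) 0 self_mem_Ici).hasDerivWithinAt
  have h2 := hasDerivWithinAt_iff_tendsto_slope.1 h1
  rw [Ici_sdiff_left] at h2
  refine h2.congr fun r => ?_
  rw [slope_def_field, hψ.zero, sub_zero, sub_zero]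

/-- `ψ` is comparable to `max r (r ^ α)` on the whole half-line. -/
theorem IsModelFunction.exists_comparable (hψ : IsModelFunction ψ) {α : ℝ} (hα : 1 < α)
    (hg : HasPowerGrowth ψ α) :
    ∃ c C : ℝ, 0 < c ∧ 0 < C ∧
      ∀ r, 0 ≤ r → c * max r (r ^ α) ≤ ψ r ∧ ψ r ≤ C * max r (r ^ α) := by
  obtain ⟨κ₁, κ₂, hκ₁, hκ₂, hκ⟩ := hg
  obtain ⟨R, hR⟩ := eventually_atTop.1 (hκ.and (eventually_ge_atTop 1))
  have h0 : ∀ᶠ r in 𝓝[>] (0 : ℝ), (1 / 2 < ψ r / r ∧ ψ r / r < 2) ∧ r ∈ Ioo 0 1 :=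
    ((hψ.tendsto_div.eventually (lt_mem_nhds (by norm_num))).and
      (hψ.tendsto_div.eventually (gt_mem_nhds (by norm_num)))).and (Ioo_mem_nhdsGT one_pos)
  obtain ⟨δ, hδ, hδ'⟩ := mem_nhdsGT_iff_exists_Ioc_subset.1 h0
  have hδ0 : 0 < δ := hδ
  -- Near `0` the comparison is with `r` because `ψ'(0) = 1`, and for large `r` with `r ^ α`;
  -- compactness covers the interval in between.
  have hcont : ContinuousOn (fun r => ψ r / max r (r ^ α)) (Icc δ (max δ R)) := by
    refine (hψ.smooth.continuousOn.mono fun r hr => hδ0.le.trans hr.1).div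
      (continuous_id.max (continuous_id.rpow_const fun _ => .inr (by linarith))).continuousOn
      fun r hr => (lt_max_of_lt_left (hδ0.trans_le hr.1)).ne'
  have hne : (Icc δ (max δ R)).Nonempty := ⟨δ, le_rfl, le_max_left _ _⟩
  obtain ⟨x, hx, hxmin⟩ := isCompact_Icc.exists_isMinOn hne hcont
  obtain ⟨y, hy, hymax⟩ := isCompact_Icc.exists_isMaxOn hne hcont
  have hx0 : 0 < x := hδ0.trans_le hx.1
  have hq0 : 0 < ψ x / max x (x ^ α) := div_pos (hψ.pos x hx0) (lt_max_of_lt_left hx0)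
  refine ⟨min (min (1 / 2) κ₁) (ψ x / max x (x ^ α)),
    max (max 2 κ₂) (ψ y / max y (y ^ α)), lt_min (lt_min (by norm_num) hκ₁) hq0,
    lt_max_of_lt_left (lt_max_of_lt_left two_pos), fun r hr => ?_⟩
  rcases hr.eq_or_lt with rfl | hr
  · rw [Real.zero_rpow (by linarith), max_self, mul_zero, mul_zero, hψ.zero]
    exact ⟨le_rfl, le_rfl⟩
  have hmax : 0 < max r (r ^ α) := lt_max_of_lt_left hr
  rw [← le_div_iff₀ hmax, ← div_le_iff₀ hmax]
  rcases le_or_gt r δ with h | h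
  · obtain ⟨⟨h1, h2⟩, h3⟩ := hδ' ⟨hr, h⟩
    have hm : r ^ α ≤ r := by simpa using Real.rpow_le_rpow_of_exponent_ge h3.1 h3.2.le hα.le
    rw [show max r (r ^ α) = r from max_eq_left hm]
    exact ⟨(min_le_left _ _).trans ((min_le_left _ _).trans h1.le),
      h2.le.trans ((le_max_left _ _).trans (le_max_left _ _))⟩
  rcases le_or_gt r (max δ R) with h' | h'
  · exact ⟨(min_le_right _ _).trans (hxmin ⟨h.le, h'⟩),
      le_trans (hymax ⟨h.le, h'⟩) (le_max_right _ _)⟩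
  · obtain ⟨⟨h1, h2⟩, h3⟩ := hR r ((le_max_right _ _).trans h'.le)
    have hm : r ≤ r ^ α := by simpa using Real.rpow_le_rpow_of_exponent_le h3 hα.le
    rw [show max r (r ^ α) = r ^ α from max_eq_right hm]
    have hrα : 0 < r ^ α := Real.rpow_pos_of_pos hr _
    rw [le_div_iff₀ hrα, div_le_iff₀ hrα]
    exact ⟨(mul_le_mul_of_nonneg_right ((min_le_left _ _).trans (min_le_right _ _))
        hrα.le).trans h1,
      h2.trans (mul_le_mul_of_nonneg_right ((le_max_right _ _).trans (le_max_left _ _)) hrα.le)⟩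

/-- The density `ψ(r)^(n-1)` of the Riemannian volume in polar coordinates, extended evenly. -/
noncomputable def modelWeight (ψ : ℝ → ℝ) (n : ℕ) (r : ℝ) : ℝ := ψ |r| ^ (n - 1)

theorem modelWeight_of_nonneg {n : ℕ} {r : ℝ} (hr : 0 ≤ r) : modelWeight ψ n r = ψ r ^ (n - 1) := by
  rw [modelWeight, abs_of_nonneg hr]

/-- `ψ` itself need not be monotone, but `max r (r ^ α)` is, so comparability gives almost
monotonicity with constant `(C / c) ^ (n - 1)`. -/
theorem IsModelFunction.exists_modelWeight_bounds (hψ : IsModelFunction ψ) {n : ℕ} (hn : 2 ≤ n)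
    {α : ℝ} (hα : 1 < α) (hg : HasPowerGrowth ψ α) :
    ∃ K c C : ℝ, IsRadialWeight (modelWeight ψ n) K ∧ 0 < c ∧
      (∀ r, 0 ≤ r → c * r ^ (α * ((n : ℝ) - 1)) ≤ modelWeight ψ n r) ∧
      ∀ R, 1 ≤ R → ∫ t in (0 : ℝ)..R, modelWeight ψ n t ≤ C * R ^ (α * ((n : ℝ) - 1) + 1) := by
  obtain ⟨c, C, hc, hC, hcC⟩ := hψ.exists_comparable hα hg
  have hn1 : ((n - 1 : ℕ) : ℝ) = (n : ℝ) - 1 := by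
    rw [Nat.cast_sub (by omega), Nat.cast_one]
  have hpow : ∀ r : ℝ, 0 ≤ r → (r ^ α) ^ (n - 1) = r ^ (α * ((n : ℝ) - 1)) := fun r hr => by
    rw [← Real.rpow_natCast, ← Real.rpow_mul hr, hn1]
  have hmono : ∀ s t : ℝ, 0 ≤ s → s ≤ t → max s (s ^ α) ≤ max t (t ^ α) := fun s t hs hst =>
    max_le_max hst (Real.rpow_le_rpow hs hst (by linarith))
  have hcont : Continuous (modelWeight ψ n) := by
    refine Continuous.pow ?_ _
    exact hψ.smooth.continuousOn.comp_continuous continuous_abs fun r => abs_nonneg r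
  refine ⟨(C / c) ^ (n - 1), c ^ (n - 1), C ^ (n - 1), ⟨hcont, ?_, fun r hr => ?_, by positivity,
    fun t s hts => ?_⟩, by positivity, fun r hr => ?_, fun R hR => ?_⟩
  · rw [modelWeight, abs_zero, hψ.zero, zero_pow (by omega)]
  · exact pow_pos (hψ.pos _ (abs_pos.2 hr)) _
  · rw [modelWeight, modelWeight, ← mul_pow]
    refine pow_le_pow_left₀ (hψ.nonneg (abs_nonneg t)) ?_ _
    calc ψ |t| ≤ C * max |t| (|t| ^ α) := (hcC _ (abs_nonneg t)).2
      _ ≤ C * max |s| (|s| ^ α) := mul_le_mul_of_nonneg_left (hmono _ _ (abs_nonneg t) hts) hC.le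
      _ = C / c * (c * max |s| (|s| ^ α)) := by field_simp
      _ ≤ _ := mul_le_mul_of_nonneg_left (hcC _ (abs_nonneg s)).1 (by positivity)
  · rw [modelWeight_of_nonneg hr, ← hpow r hr, ← mul_pow]
    exact pow_le_pow_left₀ (by positivity)
      ((mul_le_mul_of_nonneg_left (le_max_right _ _) hc.le).trans (hcC r hr).1) _
  · have hR0 : 0 < R := by linarith
    have h := intervalIntegral.integral_mono_on (μ := volume) hR0.le
      (hcont.intervalIntegrable _ _)
      (intervalIntegrable_const (c := C ^ (n - 1) * R ^ (α * ((n : ℝ) - 1)))) fun t ht => by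
        rw [modelWeight_of_nonneg ht.1, ← hpow R hR0.le, ← mul_pow]
        refine pow_le_pow_left₀ (hψ.nonneg ht.1) ?_ _
        refine (hcC t ht.1).2.trans (mul_le_mul_of_nonneg_left ?_ hC.le)
        refine (hmono t R ht.1 ht.2).trans (max_le ?_ le_rfl)
        simpa using Real.rpow_le_rpow_of_exponent_le hR hα.le
    rw [intervalIntegral.integral_const, smul_eq_mul, sub_zero] at h
    rw [Real.rpow_add hR0, Real.rpow_one]
    linarith

end ModelWeight

/-! ### The metric in Cartesian coordinates and the distance to the pole. -/

section Metric

variable {n : ℕ} {ψ : ℝ → ℝ}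

theorem sum_mul_self_eq_norm_sq (x : EuclideanSpace ℝ (Fin n)) : ∑ i, x i * x i = ‖x‖ ^ 2 := by
  rw [EuclideanSpace.real_norm_sq_eq]
  exact Finset.sum_congr rfl fun i _ => by ring

theorem metric_zero : metric n ψ 0 = 1 := if_pos rfl

theorem metric_of_ne_zero {x : EuclideanSpace ℝ (Fin n)} (hx : x ≠ 0) :
    metric n ψ x = Matrix.of fun i j =>
    x i * x j / ‖x‖ ^ 2 +
      (ψ ‖x‖ / ‖x‖) ^ 2 * ((1 : Matrix (Fin n) (Fin n) ℝ) i j - x i * x j / ‖x‖ ^ 2) := if_neg hx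

theorem metric_mulVec_self (x : EuclideanSpace ℝ (Fin n)) : (metric n ψ x).mulVec x = x := by
  rcases eq_or_ne x 0 with rfl | hx
  · rw [metric_zero, Matrix.one_mulVec]
  have hr : ‖x‖ ^ 2 ≠ 0 := pow_ne_zero 2 (norm_ne_zero_iff.2 hx)
  ext i
  rw [metric_of_ne_zero hx, Matrix.mulVec, dotProduct]
  simp only [Matrix.of_apply]
  have h1 : ∀ j, (x i * x j / ‖x‖ ^ 2 + (ψ ‖x‖ / ‖x‖) ^ 2 *
      ((1 : Matrix (Fin n) (Fin n) ℝ) i j - x i * x j / ‖x‖ ^ 2)) * x j =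
      (1 - (ψ ‖x‖ / ‖x‖) ^ 2) * (x i / ‖x‖ ^ 2) * (x j * x j) +
        (ψ ‖x‖ / ‖x‖) ^ 2 * ((1 : Matrix (Fin n) (Fin n) ℝ) i j * x j) := fun j => by ring
  simp only [h1, Finset.sum_add_distrib, ← Finset.mul_sum, sum_mul_self_eq_norm_sq]
  have h2 : ∑ j, (1 : Matrix (Fin n) (Fin n) ℝ) i j * x j = x i := by
    simp [Matrix.one_apply]
  rw [h2]
  field_simp
  ring

/-- The metric is a multiple of a rank-one perturbation of the identity, so the matrix determinant
lemma applies. -/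
theorem det_metric {x : EuclideanSpace ℝ (Fin n)} (hx : x ≠ 0) (hψx : 0 < ψ ‖x‖) (hn : 1 ≤ n) :
    (metric n ψ x).det = ((ψ ‖x‖ / ‖x‖) ^ (n - 1)) ^ 2 := by
  have hr : 0 < ‖x‖ := norm_pos_iff.2 hx
  have hs : 0 < ψ ‖x‖ / ‖x‖ := div_pos hψx hr
  set s := ψ ‖x‖ / ‖x‖ with hs'
  have h1 : metric n ψ x = s ^ 2 • (1 + Matrix.replicateCol Unit (x : Fin n → ℝ) *
      Matrix.replicateRow Unit (fun j => ((s ^ 2)⁻¹ - 1) / ‖x‖ ^ 2 * x j)) := by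
    ext i j
    rw [metric_of_ne_zero hx]
    simp only [Matrix.of_apply, Matrix.smul_apply, Matrix.add_apply, Matrix.mul_apply,
      Matrix.replicateCol_apply, Matrix.replicateRow_apply, Finset.univ_unique, Finset.sum_const,
      Finset.card_singleton, one_smul, smul_eq_mul]
    rw [← hs']
    field_simp
    ring
  have h2 : (fun j => ((s ^ 2)⁻¹ - 1) / ‖x‖ ^ 2 * x j) ⬝ᵥ (x : Fin n → ℝ) = (s ^ 2)⁻¹ - 1 := by
    simp only [dotProduct, mul_assoc, ← Finset.mul_sum, sum_mul_self_eq_norm_sq]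
    field_simp
  rw [h1, Matrix.det_smul, Matrix.det_one_add_replicateCol_mul_replicateRow, h2, Fintype.card_fin]
  obtain ⟨m, rfl⟩ : ∃ m, n = m + 1 := ⟨n - 1, by omega⟩
  rw [add_tsub_cancel_right, add_sub_cancel, ← pow_mul, ← pow_mul, mul_add, pow_add, mul_comm m 2]
  field_simp

/-- The ratio of the Riemannian volume density to the Euclidean one. -/
noncomputable def volumeRatio (ψ : ℝ → ℝ) (n : ℕ) (r : ℝ) : ℝ :=
  if r = 0 then 1 else (ψ r / r) ^ (n - 1)

theorem sqrt_det_metric (hψ : IsModelFunction ψ) (hn : 1 ≤ n) (x : EuclideanSpace ℝ (Fin n)) :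
    √(metric n ψ x).det = volumeRatio ψ n ‖x‖ := by
  rcases eq_or_ne x 0 with rfl | hx
  · rw [metric_zero, Matrix.det_one, Real.sqrt_one, norm_zero, volumeRatio, if_pos rfl]
  have hr : 0 < ‖x‖ := norm_pos_iff.2 hx
  rw [det_metric hx (hψ.pos _ hr) hn, volumeRatio, if_neg hr.ne', Real.sqrt_sq]
  exact pow_nonneg (div_nonneg (hψ.pos _ hr).le hr.le) _

theorem volumeRatio_pos (hψ : IsModelFunction ψ) {r : ℝ} (hr : 0 ≤ r) :
    0 < volumeRatio ψ n r := by
  rw [volumeRatio]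
  split_ifs with h
  · exact one_pos
  · have := hr.lt_of_ne' h
    exact pow_pos (div_pos (hψ.pos r this) this) _

theorem inv_metric_mulVec_self (hψ : IsModelFunction ψ) (hn : 1 ≤ n)
    (x : EuclideanSpace ℝ (Fin n)) : (metric n ψ x)⁻¹.mulVec x = x := by
  have hdet : IsUnit (metric n ψ x).det := by
    refine isUnit_iff_ne_zero.2 fun h => ?_
    have := sqrt_det_metric hψ hn x
    rw [h, Real.sqrt_zero] at this
    exact (volumeRatio_pos hψ (norm_nonneg x)).ne this
  conv_lhs => rw [← metric_mulVec_self (ψ := ψ) x]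
  rw [Matrix.mulVec_mulVec, Matrix.nonsing_inv_mul _ hdet, Matrix.one_mulVec]

theorem metric_form {x : EuclideanSpace ℝ (Fin n)} (hx : x ≠ 0) (v : EuclideanSpace ℝ (Fin n)) :
    ∑ i, ∑ j, metric n ψ x i j * v i * v j =
      (inner ℝ x v / ‖x‖) ^ 2 +
        (ψ ‖x‖ / ‖x‖) ^ 2 * (‖v‖ ^ 2 - (inner ℝ x v / ‖x‖) ^ 2) := by
  have hr : ‖x‖ ≠ 0 := norm_ne_zero_iff.2 hx
  have hin : inner ℝ x v = ∑ i, x i * v i := by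
    simp [PiLp.inner_apply, mul_comm]
  have h1 : ∀ i j, metric n ψ x i j * v i * v j =
      (1 - (ψ ‖x‖ / ‖x‖) ^ 2) / ‖x‖ ^ 2 * ((x i * v i) * (x j * v j)) +
        (ψ ‖x‖ / ‖x‖) ^ 2 * ((1 : Matrix (Fin n) (Fin n) ℝ) i j * v i * v j) := fun i j => by
    rw [metric_of_ne_zero hx, Matrix.of_apply]
    ring
  have h2 : ∑ i, ∑ j, (1 : Matrix (Fin n) (Fin n) ℝ) i j * v i * v j = ‖v‖ ^ 2 := by
    rw [← sum_mul_self_eq_norm_sq]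
    simp [Matrix.one_apply]
  simp only [h1, Finset.sum_add_distrib, ← Finset.mul_sum, h2, ← Finset.sum_mul]
  rw [← hin]
  field_simp
  ring

/-- The Gauss lemma: by Cauchy–Schwarz the spherical part of the metric is nonnegative, so a curve
is at least as long as the variation of its radius. -/
theorem inner_div_sq_le_metric_form {x : EuclideanSpace ℝ (Fin n)} (hx : x ≠ 0)
    (v : EuclideanSpace ℝ (Fin n)) :
    (inner ℝ x v / ‖x‖) ^ 2 ≤ ∑ i, ∑ j, metric n ψ x i j * v i * v j := by
  rw [metric_form hx]
  have hr : 0 < ‖x‖ := norm_pos_iff.2 hx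
  have h : |inner ℝ x v / ‖x‖| ≤ ‖v‖ := by
    rw [abs_div, abs_of_pos hr, div_le_iff₀ hr, mul_comm]
    exact abs_real_inner_le_norm x v
  have h2 : (inner ℝ x v / ‖x‖) ^ 2 ≤ ‖v‖ ^ 2 := sq_le_sq.2 (by rwa [abs_of_nonneg (norm_nonneg v)])
  have : 0 ≤ (ψ ‖x‖ / ‖x‖) ^ 2 * (‖v‖ ^ 2 - (inner ℝ x v / ‖x‖) ^ 2) :=
    mul_nonneg (sq_nonneg _) (by linarith)
  linarith

theorem norm_le_curveLength {γ : ℝ → EuclideanSpace ℝ (Fin n)}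
    (hγ : ContDiffOn ℝ 1 γ (Icc 0 1)) (h0 : γ 0 = 0) :
    ENNReal.ofReal ‖γ 1‖ ≤ curveLength (metric n ψ) γ := by
  by_cases h1 : γ 1 = 0
  · simp [h1]
  have hγc := hγ.continuousOn
  -- The norm is not differentiable at the pole, so the curve is measured only after its last visit
  -- there.
  obtain ⟨t₀, ht₀, ht₀max⟩ : ∃ t₀ ∈ Icc (0 : ℝ) 1, γ t₀ = 0 ∧ ∀ t ∈ Ioc t₀ 1, γ t ≠ 0 := by
    have hcomp : IsCompact (Icc (0 : ℝ) 1 ∩ γ ⁻¹' {0}) :=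
      isCompact_Icc.of_isClosed_subset
        (hγc.preimage_isClosed_of_isClosed isClosed_Icc isClosed_singleton) inter_subset_left
    obtain ⟨t, ht, htm⟩ := hcomp.exists_isGreatest ⟨0, ⟨le_rfl, zero_le_one⟩, h0⟩
    exact ⟨t, ht.1, ht.2, fun s hs hs0 =>
      absurd (htm ⟨⟨ht.1.1.trans hs.1.le, hs.2⟩, hs0⟩) (not_le.2 hs.1)⟩
  have ht₀1 : t₀ < 1 := ht₀.2.lt_of_ne fun h => h1 (h ▸ ht₀max.1)
  have hsub : Ioo t₀ 1 ⊆ Ioo 0 1 := Ioo_subset_Ioo_left ht₀.1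
  have hder : ∀ t ∈ Ioo (0 : ℝ) 1, HasDerivAt γ (deriv γ t) t := fun t ht =>
    ((hγ.differentiableOn (by simp) t (Ioo_subset_Icc_self ht)).differentiableAt
      (Icc_mem_nhds ht.1 ht.2)).hasDerivAt
  have hdc : ContinuousOn (deriv γ) (Ioo 0 1) :=
    (hγ.mono Ioo_subset_Icc_self).continuousOn_deriv_of_isOpen isOpen_Ioo le_rfl
  have hdb : ∃ C, ∀ t ∈ Ioo (0 : ℝ) 1, ‖deriv γ t‖ ≤ C := by
    obtain ⟨C, hC⟩ := isCompact_Icc.exists_bound_of_continuousOn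
      (hγ.continuousOn_derivWithin (uniqueDiffOn_Icc zero_lt_one) le_rfl)
    refine ⟨C, fun t ht => ?_⟩
    rw [← derivWithin_of_mem_nhds (Icc_mem_nhds ht.1 ht.2)]
    exact hC t (Ioo_subset_Icc_self ht)
  obtain ⟨C, hC⟩ := hdb
  set φ : ℝ → ℝ := fun t => inner ℝ (γ t) (deriv γ t) / ‖γ t‖ with hφ
  have hφder : ∀ t ∈ Ioo t₀ 1, HasDerivAt (fun t => ‖γ t‖) (φ t) t := by
    intro t ht
    have hne : γ t ≠ 0 := ht₀max.2 t (Ioo_subset_Ioc_self ht)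
    have h := (hder t (hsub ht)).norm_sq.sqrt (pow_ne_zero 2 (norm_ne_zero_iff.2 hne))
    simp only [Real.sqrt_sq (norm_nonneg _)] at h
    refine h.congr_deriv ?_
    rw [hφ, mul_div_mul_left _ _ two_ne_zero]
  have hγc' : ContinuousOn γ (Ioo t₀ 1) := hγc.mono (hsub.trans Ioo_subset_Icc_self)
  have hφc : ContinuousOn φ (Ioo t₀ 1) :=
    (hγc'.inner (hdc.mono hsub)).div hγc'.norm fun t ht =>
      norm_ne_zero_iff.2 (ht₀max.2 t (Ioo_subset_Ioc_self ht))
  have hφint : IntegrableOn φ (Ioo t₀ 1) := by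
    refine IntegrableOn.of_bound (by simp) (hφc.aestronglyMeasurable measurableSet_Ioo) C ?_
    · filter_upwards [ae_restrict_mem measurableSet_Ioo] with t ht
      have hne : 0 < ‖γ t‖ := norm_pos_iff.2 (ht₀max.2 t (Ioo_subset_Ioc_self ht))
      rw [hφ, Real.norm_eq_abs, abs_div, abs_of_pos hne, div_le_iff₀ hne]
      refine (abs_real_inner_le_norm _ _).trans ?_
      rw [mul_comm]
      exact mul_le_mul_of_nonneg_right (hC t (hsub ht)) hne.le
  have hftc : ∫ t in t₀..1, φ t = ‖γ 1‖ := by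
    rw [intervalIntegral.integral_eq_sub_of_hasDerivAt_of_le ht₀1.le
      ((hγc.mono (Icc_subset_Icc_left ht₀.1)).norm) hφder
      ((intervalIntegrable_iff_integrableOn_Ioo_of_le ht₀1.le).2 hφint), ht₀max.1, norm_zero,
      sub_zero]
  calc ENNReal.ofReal ‖γ 1‖ ≤ ENNReal.ofReal (∫ t in Ioo t₀ 1, |φ t|) := by
        refine ENNReal.ofReal_le_ofReal ?_
        rw [← hftc, intervalIntegral.integral_of_le ht₀1.le, integral_Ioc_eq_integral_Ioo]
        exact (le_abs_self _).trans abs_integral_le_integral_abs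
    _ = ∫⁻ t in Ioo t₀ 1, ENNReal.ofReal |φ t| :=
        ofReal_integral_eq_lintegral_ofReal hφint.abs (.of_forall fun t => abs_nonneg _)
    _ ≤ ∫⁻ t in Ioo t₀ 1, ENNReal.ofReal
          √(∑ i, ∑ j, metric n ψ (γ t) i j * deriv γ t i * deriv γ t j) := by
        refine setLIntegral_mono' measurableSet_Ioo fun t ht => ENNReal.ofReal_le_ofReal ?_
        rw [← Real.sqrt_sq_eq_abs]
        exact Real.sqrt_le_sqrt
          (inner_div_sq_le_metric_form (ht₀max.2 t (Ioo_subset_Ioc_self ht)) _)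
    _ ≤ _ := lintegral_mono_set hsub

theorem geodesicDist_zero (x : EuclideanSpace ℝ (Fin n)) :
    geodesicDist (metric n ψ) 0 x = ENNReal.ofReal ‖x‖ := by
  refine le_antisymm ?_ (le_iInf₂ fun γ hγ => le_iInf₂ fun h0 h1 => ?_)
  · have hc : ContDiff ℝ 1 fun t : ℝ => t • x := contDiff_id.smul contDiff_const
    refine (iInf₂_le (fun t : ℝ => t • x) hc.contDiffOn).trans
      ((iInf₂_le (zero_smul ℝ x) (one_smul ℝ x)).trans ?_)
    have hder : ∀ t : ℝ, deriv (fun t : ℝ => t • x) t = x := fun t => by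
      simpa using ((hasDerivAt_id t).smul_const x).deriv
    have hform : ∀ t ∈ Ioo (0 : ℝ) 1, ENNReal.ofReal √(∑ i, ∑ j,
        metric n ψ (t • x) i j * deriv (fun t : ℝ => t • x) t i *
          deriv (fun t : ℝ => t • x) t j) = ENNReal.ofReal ‖x‖ := by
      intro t ht
      rw [hder]
      rcases eq_or_ne x 0 with rfl | hx
      · simp
      have hr : ‖x‖ ≠ 0 := norm_ne_zero_iff.2 hx
      have e : inner ℝ (t • x) x / ‖t • x‖ = ‖x‖ := by
        rw [real_inner_smul_left, real_inner_self_eq_norm_sq, norm_smul, Real.norm_eq_abs,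
          abs_of_pos ht.1]
        have := ht.1.ne'
        field_simp
      rw [metric_form (smul_ne_zero ht.1.ne' hx), e, sub_self, mul_zero, add_zero,
        Real.sqrt_sq (norm_nonneg x)]
    rw [curveLength, setLIntegral_congr_fun measurableSet_Ioo hform]
    simp
  · rw [← h1]
    exact norm_le_curveLength hγ h0

theorem mem_geodesicBall {R : ℝ} (hR : 0 < R) {x : EuclideanSpace ℝ (Fin n)} :
    x ∈ geodesicBall (metric n ψ) R ↔ ‖x‖ < R := by
  rw [geodesicBall, Set.mem_ofPred_eq, geodesicDist_zero, ENNReal.ofReal_lt_ofReal_iff hR]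

theorem mem_geodesicSphere {R : ℝ} (hR : 0 < R) {x : EuclideanSpace ℝ (Fin n)} :
    x ∈ geodesicSphere (metric n ψ) R ↔ ‖x‖ = R := by
  rw [geodesicSphere, Set.mem_ofPred_eq, geodesicDist_zero,
    ENNReal.ofReal_eq_ofReal_iff (norm_nonneg x) hR.le]

end Metric

/-! ### The Laplace–Beltrami operator on radial functions. -/

section RadialField

variable {n : ℕ} {ψ : ℝ → ℝ}

theorem hasFDerivAt_norm_of_ne_zero {x : EuclideanSpace ℝ (Fin n)} (hx : x ≠ 0) :
    HasFDerivAt (fun y : EuclideanSpace ℝ (Fin n) => ‖y‖) (‖x‖⁻¹ • innerSL ℝ x) x := by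
  have hr : ‖x‖ ≠ 0 := norm_ne_zero_iff.2 hx
  have h := (hasStrictFDerivAt_norm_sq x).hasFDerivAt.sqrt (pow_ne_zero 2 hr)
  simp only [Real.sqrt_sq (norm_nonneg _)] at h
  refine h.congr_fderiv ?_
  ext v
  simp
  field_simp

theorem hasFDerivAt_radial_of_ne_zero {x : EuclideanSpace ℝ (Fin n)} (hx : x ≠ 0) {v : ℝ → ℝ}
    {v' : ℝ} (hv : HasDerivAt v v' ‖x‖) :
    HasFDerivAt (fun y : EuclideanSpace ℝ (Fin n) => v ‖y‖) ((v' * ‖x‖⁻¹) • innerSL ℝ x) x := by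
  have := hv.comp_hasFDerivAt x (hasFDerivAt_norm_of_ne_zero hx)
  rwa [smul_smul] at this

theorem hasFDerivAt_radialField_of_ne_zero {x : EuclideanSpace ℝ (Fin n)} (hx : x ≠ 0)
    {k : ℝ → ℝ} {k' : ℝ} (hk : HasDerivAt k k' ‖x‖) :
    HasFDerivAt (fun y : EuclideanSpace ℝ (Fin n) => k ‖y‖ • y)
      (k ‖x‖ • ContinuousLinearMap.id ℝ _ + (k' * ‖x‖⁻¹) • (innerSL ℝ x).smulRight x) x := by
  have := (hasFDerivAt_radial_of_ne_zero hx hk).smul (hasFDerivAt_id x)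
  refine this.congr_fderiv ?_
  ext v
  simp [mul_assoc]

/-- The factor `y` vanishes at the origin, so continuity of `k` there suffices. -/
theorem hasFDerivAt_radialField_zero {k : ℝ → ℝ}
    (hk : ContinuousAt (fun y : EuclideanSpace ℝ (Fin n) => k ‖y‖) 0) :
    HasFDerivAt (fun y : EuclideanSpace ℝ (Fin n) => k ‖y‖ • y)
      (k 0 • ContinuousLinearMap.id ℝ _) 0 := by
  rw [hasFDerivAt_iff_isLittleO_nhds_zero, Asymptotics.isLittleO_iff]
  intro c hc
  filter_upwards [Metric.continuousAt_iff'.1 hk c hc] with y hy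
  rw [dist_eq_norm, norm_zero] at hy
  simp only [zero_add, norm_zero, smul_zero, sub_zero, smul_apply,
    ContinuousLinearMap.id_apply]
  rw [← sub_smul, norm_smul]
  exact mul_le_mul_of_nonneg_right hy.le (norm_nonneg y)

theorem continuousAt_radial_zero {k : ℝ → ℝ} (hk : Tendsto k (𝓝[>] 0) (𝓝 (k 0))) :
    ContinuousAt (fun y : EuclideanSpace ℝ (Fin n) => k ‖y‖) 0 := by
  rw [continuousAt_iff_punctured_nhds, norm_zero]
  exact hk.comp tendsto_norm_nhdsNE_zero

theorem sum_partialDeriv_radialField {x : EuclideanSpace ℝ (Fin n)} {k : ℝ → ℝ}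
    {D : EuclideanSpace ℝ (Fin n) →L[ℝ] EuclideanSpace ℝ (Fin n)}
    (hD : HasFDerivAt (fun y : EuclideanSpace ℝ (Fin n) => k ‖y‖ • y) D x) :
    ∑ i, partialDeriv i (fun y => -(k ‖y‖ * y i)) x =
      -∑ i, D (EuclideanSpace.single i 1) i := by
  rw [← Finset.sum_neg_distrib]
  refine Finset.sum_congr rfl fun i _ => ?_
  have h := ((EuclideanSpace.proj (𝕜 := ℝ) i).hasFDerivAt.comp x hD).neg
  rw [partialDeriv, HasFDerivAt.fderiv (f := fun y => -(k ‖y‖ * y i)) (h.congr_of_eventuallyEq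
    (.of_forall fun y => by simp))]
  simp

theorem sum_partialDeriv_radialField_of_ne_zero {x : EuclideanSpace ℝ (Fin n)} (hx : x ≠ 0)
    {k : ℝ → ℝ} {k' : ℝ} (hk : HasDerivAt k k' ‖x‖) :
    ∑ i, partialDeriv i (fun y => -(k ‖y‖ * y i)) x = -(n * k ‖x‖ + ‖x‖ * k') := by
  have hr : ‖x‖ ≠ 0 := norm_ne_zero_iff.2 hx
  rw [sum_partialDeriv_radialField (hasFDerivAt_radialField_of_ne_zero hx hk)]
  congr 1
  have : ∀ i, (k ‖x‖ • ContinuousLinearMap.id ℝ (EuclideanSpace ℝ (Fin n)) +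
      (k' * ‖x‖⁻¹) • (innerSL ℝ x).smulRight x) (EuclideanSpace.single i 1) i =
        k ‖x‖ + k' * ‖x‖⁻¹ * (x i * x i) := fun i => by
    simp [EuclideanSpace.inner_single_right]
  simp only [this, Finset.sum_add_distrib, ← Finset.mul_sum, sum_mul_self_eq_norm_sq]
  simp
  field_simp

theorem sum_partialDeriv_radialField_zero {k : ℝ → ℝ}
    (hk : ContinuousAt (fun y : EuclideanSpace ℝ (Fin n) => k ‖y‖) 0) :
    ∑ i, partialDeriv i (fun y => -(k ‖y‖ * y i)) (0 : EuclideanSpace ℝ (Fin n)) =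
      -(n * k 0) := by
  rw [sum_partialDeriv_radialField (hasFDerivAt_radialField_zero hk)]
  simp

/-- The inverse metric fixes `y`, so a radial gradient is not changed by raising indices and only a
Euclidean divergence remains. -/
theorem laplaceBeltrami_of_radial_gradient (hψ : IsModelFunction ψ) (hn : 1 ≤ n)
    {u : EuclideanSpace ℝ (Fin n) → ℝ} {k : ℝ → ℝ} {x : EuclideanSpace ℝ (Fin n)}
    (hu : ∀ᶠ y in 𝓝 x, ∀ j, partialDeriv j u y = -(k ‖y‖ * y j)) :
    laplaceBeltrami (metric n ψ) u x = (volumeRatio ψ n ‖x‖)⁻¹ *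
      ∑ i, partialDeriv i (fun y => -(volumeRatio ψ n ‖y‖ * k ‖y‖ * y i)) x := by
  rw [laplaceBeltrami, sqrt_det_metric hψ hn]
  congr 1
  refine Finset.sum_congr rfl fun i _ => ?_
  rw [partialDeriv, partialDeriv]
  congr 1
  refine Filter.EventuallyEq.fderiv_eq ?_
  filter_upwards [hu] with y hy
  have h : ∑ j, (metric n ψ y)⁻¹ i j * y j = y i :=
    congrFun (inv_metric_mulVec_self hψ hn y) i
  simp only [sqrt_det_metric hψ hn, hy, mul_neg, Finset.sum_neg_distrib, mul_left_comm _ (k ‖y‖),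
    ← Finset.mul_sum, h]
  ring

/-- Away from the pole, `-Δ u = P' / w` where `P = w k` and `∇ u = -k(r) x / r`. -/
theorem laplaceBeltrami_of_ne_zero (hψ : IsModelFunction ψ) (hn : 1 ≤ n)
    {u : EuclideanSpace ℝ (Fin n) → ℝ} {k : ℝ → ℝ} {x : EuclideanSpace ℝ (Fin n)} (hx : x ≠ 0)
    (hu : ∀ᶠ y in 𝓝 x, ∀ j, partialDeriv j u y = -(k ‖y‖ / ‖y‖ * y j)) {P' : ℝ}
    (hP : HasDerivAt (fun r => modelWeight ψ n r * k r) P' ‖x‖) :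
    -laplaceBeltrami (metric n ψ) u x = P' / modelWeight ψ n ‖x‖ := by
  have hr : 0 < ‖x‖ := norm_pos_iff.2 hx
  have hψr := hψ.pos _ hr
  rw [laplaceBeltrami_of_radial_gradient (k := fun r => k r / r) hψ hn hu]
  obtain ⟨m, rfl⟩ : ∃ m, n = m + 1 := ⟨n - 1, by omega⟩
  -- The field becomes `w k x / r ^ n`; as `x / r ^ n` has zero divergence, only the derivative of
  -- `w k` survives.
  have hχ : (fun r => volumeRatio ψ (m + 1) r * (k r / r)) =ᶠ[𝓝 ‖x‖]
      fun r => modelWeight ψ (m + 1) r * k r / r ^ (m + 1) := by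
    filter_upwards [lt_mem_nhds hr] with r hr
    rw [volumeRatio, if_neg hr.ne', modelWeight_of_nonneg hr.le, add_tsub_cancel_right, div_pow,
      pow_succ]
    field_simp
  have hder := (hP.div (hasDerivAt_pow (m + 1) ‖x‖) (pow_ne_zero _ hr.ne')).congr_of_eventuallyEq hχ
  rw [sum_partialDeriv_radialField_of_ne_zero hx hder, volumeRatio,
    if_neg hr.ne', modelWeight_of_nonneg hr.le]
  simp only [add_tsub_cancel_right, div_pow]
  push_cast
  have := pow_pos hψr m
  have := pow_pos hr m
  field_simp
  ring

theorem laplaceBeltrami_zero (hψ : IsModelFunction ψ) (hn : 1 ≤ n)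
    {u : EuclideanSpace ℝ (Fin n) → ℝ} {k : ℝ → ℝ} (hk : Tendsto k (𝓝[>] 0) (𝓝 (k 0)))
    (hu : ∀ᶠ y in 𝓝 (0 : EuclideanSpace ℝ (Fin n)), ∀ j, partialDeriv j u y = -(k ‖y‖ * y j)) :
    -laplaceBeltrami (metric n ψ) u 0 = n * k 0 := by
  have hS : Tendsto (volumeRatio ψ n) (𝓝[>] 0) (𝓝 (volumeRatio ψ n 0)) := by
    rw [volumeRatio, if_pos rfl, ← one_pow (n - 1)]
    refine (hψ.tendsto_div.pow (n - 1)).congr' ?_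
    filter_upwards [self_mem_nhdsWithin] with r hr
    rw [volumeRatio, if_neg (ne_of_gt hr)]
  rw [laplaceBeltrami_of_radial_gradient hψ hn hu,
    sum_partialDeriv_radialField_zero (k := fun r => volumeRatio ψ n r * k r)
      (continuousAt_radial_zero (hS.mul hk)), norm_zero, volumeRatio, if_pos rfl]
  ring

end RadialField

/-! ### Passage between radial profiles and solutions on the manifold. -/

section Profiles

variable {n : ℕ} {ψ : ℝ → ℝ}

theorem IsModelFunction.hasDerivAt_modelWeight (hψ : IsModelFunction ψ) (hn : 1 ≤ n) {r : ℝ}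
    (hr : 0 < r) : HasDerivAt (modelWeight ψ n)
      (((n : ℝ) - 1) * (derivWithin ψ (Ici 0) r / ψ r) * modelWeight ψ n r) r := by
  have h := (hψ.hasDerivAt hr).pow (n - 1)
  have e : modelWeight ψ n =ᶠ[𝓝 r] ψ ^ (n - 1) := by
    filter_upwards [lt_mem_nhds hr] with s hs
    rw [modelWeight_of_nonneg hs.le, Pi.pow_apply]
  refine (h.congr_of_eventuallyEq e).congr_deriv ?_
  have hψr := (hψ.pos r hr).ne'
  rw [modelWeight_of_nonneg hr.le, Nat.cast_sub hn, Nat.cast_one]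
  rcases Nat.eq_or_lt_of_le hn with rfl | hn'
  · simp
  · obtain ⟨m, rfl⟩ : ∃ m, n = m + 2 := ⟨n - 2, by omega⟩
    simp only [show m + 2 - 1 = m + 1 by omega, add_tsub_cancel_right, pow_succ]
    field_simp

theorem IsModelFunction.tendsto_log_deriv (hψ : IsModelFunction ψ) :
    Tendsto (fun r => r * (derivWithin ψ (Ici 0) r / ψ r)) (𝓝[>] 0) (𝓝 1) := by
  have h1 : Tendsto (derivWithin ψ (Ici 0)) (𝓝[>] 0) (𝓝 1) := by
    rw [← hψ.deriv_zero]
    exact (hψ.continuousOn_deriv 0 self_mem_Ici).mono_left (nhdsWithin_mono _ Ioi_subset_Ici_self)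
  have h2 := h1.div hψ.tendsto_div one_ne_zero
  rw [div_one] at h2
  refine h2.congr' ?_
  filter_upwards [self_mem_nhdsWithin] with r hr
  have := (hψ.pos r hr).ne'
  have hr' : r ≠ 0 := ne_of_gt hr
  simp only [Pi.div_apply]
  field_simp

variable {K : ℝ}

/-- L'Hôpital's rule for `∫₀ʳ w h` over `r w`: the denominator has derivative `w (1 + (n - 1) r ψ' /
ψ)`, and the bracket tends to `n`. -/
theorem tendsto_avgFlux_div (hψ : IsModelFunction ψ) (hn : 1 ≤ n)
    (hw : IsRadialWeight (modelWeight ψ n) K) {h : ℝ → ℝ} (hh : Continuous h) :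
    Tendsto (fun r => avgFlux (modelWeight ψ n) h r / r) (𝓝[>] 0) (𝓝 (h 0 / n)) := by
  have hn0 : (0 : ℝ) < n := by exact_mod_cast hn
  have hwpos : ∀ᶠ r in 𝓝[>] (0 : ℝ), 0 < r ∧ 0 < modelWeight ψ n r := by
    filter_upwards [self_mem_nhdsWithin] with r hr
    exact ⟨hr, hw.pos r (ne_of_gt hr)⟩
  have hden : Tendsto (fun r => 1 + ((n : ℝ) - 1) * (r * (derivWithin ψ (Ici 0) r / ψ r)))
      (𝓝[>] 0) (𝓝 n) := by
    have := (hψ.tendsto_log_deriv.const_mul ((n : ℝ) - 1)).const_add 1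
    simpa using this
  have key := HasDerivAt.lhopital_zero_nhdsGT (a := 0) (l := 𝓝 (h 0 / n))
    (f := fun r => ∫ t in (0 : ℝ)..r, modelWeight ψ n t * h t)
    (f' := fun r => modelWeight ψ n r * h r)
    (g := fun r => r * modelWeight ψ n r)
    (g' := fun r => modelWeight ψ n r *
      (1 + ((n : ℝ) - 1) * (r * (derivWithin ψ (Ici 0) r / ψ r))))
    (.of_forall fun r => hw.hasDerivAt_primitive hh r) ?_ ?_ ?_ ?_ ?_
  · refine key.congr fun r => ?_
    rw [avgFlux, div_mul_eq_div_div, div_right_comm, div_eq_inv_mul (∫ _ in _.._, _)]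
  · filter_upwards [self_mem_nhdsWithin] with r hr
    refine ((hasDerivAt_id r).mul (hψ.hasDerivAt_modelWeight hn hr)).congr_deriv ?_
    simp only [id]
    ring
  · filter_upwards [hwpos, hden.eventually (lt_mem_nhds hn0)] with r h1 h2
    exact (mul_pos h1.2 h2).ne'
  · have := (intervalIntegral.continuous_primitive (fun a b => hw.intervalIntegrable hh a b)
      0).tendsto 0
    rw [intervalIntegral.integral_same] at this
    exact this.mono_left nhdsWithin_le_nhds
  · have := (continuous_id.mul hw.continuous).tendsto 0
    simp only [Pi.mul_apply, id, zero_mul] at this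
    exact this.mono_left nhdsWithin_le_nhds
  · refine (((hh.tendsto 0).mono_left nhdsWithin_le_nhds).div hden hn0.ne').congr' ?_
    filter_upwards [hwpos] with r hr
    simp only [Pi.div_apply]
    rw [mul_div_mul_left _ _ hr.2.ne']

/-- A solution of the radial integral equation defines a `C²` solution on the manifold. -/
theorem contDiff_and_equation_of_profile (hψ : IsModelFunction ψ) (hn : 1 ≤ n)
    (hw : IsRadialWeight (modelWeight ψ n) K) {g v : ℝ → ℝ} {a : ℝ} (hg : Continuous g)
    (hv : Continuous v)
    (hva : ∀ r, v r = a - ∫ s in (0 : ℝ)..r, avgFlux (modelWeight ψ n) (fun t => g (v t)) s) :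
    ContDiff ℝ 2 (fun x : EuclideanSpace ℝ (Fin n) => v ‖x‖) ∧
      ∀ x : EuclideanSpace ℝ (Fin n),
        -laplaceBeltrami (metric n ψ) (fun x => v ‖x‖) x = g (v ‖x‖) := by
  have hn0 : (n : ℝ) ≠ 0 := by
    have : 0 < n := hn
    exact_mod_cast this.ne'
  have hgv : Continuous fun t => g (v t) := hg.comp hv
  set k := avgFlux (modelWeight ψ n) (fun t => g (v t)) with hk
  have hkc : Continuous k := hw.continuous_avgFlux hgv
  have hvd : ∀ r, HasDerivAt v (-k r) r := fun r => by
    have h := ((hkc.integral_hasStrictDerivAt 0 r).hasDerivAt).const_sub a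
    exact h.congr_of_eventuallyEq (.of_forall hva)
  -- The gradient of the solution is `-κ(‖x‖) x`; the value at `0` is the limit of the flux divided
  -- by `r`.
  set κ : ℝ → ℝ := fun r => if r = 0 then g (v 0) / n else k r / r with hκ
  have hκ0 : κ 0 = g (v 0) / n := if_pos rfl
  have hκr : ∀ r, 0 < r → κ r = k r / r := fun r hr => if_neg hr.ne'
  have hκlim : Tendsto κ (𝓝[>] 0) (𝓝 (κ 0)) := by
    rw [hκ0]
    refine (tendsto_avgFlux_div hψ hn hw hgv).congr' ?_
    filter_upwards [self_mem_nhdsWithin] with r hr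
    rw [hκr r hr]
  set μ : ℝ → ℝ := fun r => r * (derivWithin ψ (Ici 0) r / ψ r) with hμ
  -- `η = r κ'`. It tends to `g(v 0) - n * (g(v 0) / n) = 0` at the pole, which is what makes the
  -- gradient `C¹` there.
  set η : ℝ → ℝ := fun r => g (v r) - (((n : ℝ) - 1) * μ r + 1) * κ r with hη
  have hkd : ∀ r, 0 < r → HasDerivAt k
      (g (v r) - ((n : ℝ) - 1) * (derivWithin ψ (Ici 0) r / ψ r) * k r) r := by
    intro r hr
    have hwr := (hw.pos r hr.ne').ne'
    refine (((hψ.hasDerivAt_modelWeight hn hr).inv hwr).mul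
      (hw.hasDerivAt_primitive hgv r)).congr_deriv ?_
    rw [hk, avgFlux]
    simp only [Pi.inv_apply]
    field_simp
    ring
  have hκd : ∀ r, 0 < r → HasDerivAt κ (η r / r) r := by
    intro r hr
    have e : κ =ᶠ[𝓝 r] fun r => k r / r := by
      filter_upwards [lt_mem_nhds hr] with s hs
      exact hκr s hs
    refine (((hkd r hr).div (hasDerivAt_id r) hr.ne').congr_of_eventuallyEq e).congr_deriv ?_
    have hψr := (hψ.pos r hr).ne'
    simp only [hη, hμ, hκr r hr, id]
    field_simp
    ring
  have hηlim : Tendsto η (𝓝[>] 0) (𝓝 0) := by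
    have h1 := ((hgv.tendsto 0).mono_left (nhdsWithin_le_nhds (s := Ioi 0))).sub
      (((hψ.tendsto_log_deriv.const_mul ((n : ℝ) - 1)).add_const 1).mul hκlim)
    rw [hκ0, show g (v 0) - (((n : ℝ) - 1) * 1 + 1) * (g (v 0) / n) = 0 by field_simp; ring] at h1
    exact h1
  have hηc : ∀ r, 0 < r → ContinuousAt η r := by
    intro r hr
    have h1 : ContinuousAt (derivWithin ψ (Ici 0)) r :=
      (hψ.continuousOn_deriv r hr.le).continuousAt (Ici_mem_nhds hr)
    have h2 := (hψ.hasDerivAt hr).continuousAt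
    exact hgv.continuousAt.sub (((continuousAt_const.mul
      (continuousAt_id.mul (h1.div h2 (hψ.pos r hr).ne'))).add continuousAt_const).mul
        (hκd r hr).continuousAt)
  -- first derivative
  have hfd : ∀ x : EuclideanSpace ℝ (Fin n),
      HasFDerivAt (fun x : EuclideanSpace ℝ (Fin n) => v ‖x‖) (innerSL ℝ (-(κ ‖x‖ • x))) x := by
    intro x
    rcases eq_or_ne x 0 with rfl | hx
    · rw [smul_zero, neg_zero, map_zero, hasFDerivAt_iff_isLittleO_nhds_zero]
      have h1 : (fun r => v r - v 0) =o[𝓝 0] fun r : ℝ => r := by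
        have := (hasDerivAt_iff_isLittleO_nhds_zero.1 (hvd 0))
        rw [hk, avgFlux_zero] at this
        simpa using this
      have h2 : Tendsto (fun h : EuclideanSpace ℝ (Fin n) => ‖h‖) (𝓝 0) (𝓝 0) := by
        simpa using (continuous_norm (E := EuclideanSpace ℝ (Fin n))).tendsto 0
      have h3 := Asymptotics.isLittleO_norm_right.1 (h1.comp_tendsto h2)
      simpa [Function.comp_def] using h3
    · refine (hasFDerivAt_radial_of_ne_zero hx (hvd ‖x‖)).congr_fderiv ?_
      rw [hκr _ (norm_pos_iff.2 hx), map_neg, map_smul, div_eq_mul_inv, neg_mul, neg_smul]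
  -- second derivative
  have hF : ContDiff ℝ 1 fun x : EuclideanSpace ℝ (Fin n) => κ ‖x‖ • x := by
    rw [contDiff_one_iff_hasFDerivAt]
    refine ⟨fun x => κ ‖x‖ • ContinuousLinearMap.id ℝ _ +
      (η ‖x‖ / ‖x‖ * ‖x‖⁻¹) • (innerSL ℝ x).smulRight x, ?_, fun x => ?_⟩
    · rw [continuous_iff_continuousAt]
      intro x
      rcases eq_or_ne x 0 with rfl | hx
      · refine ((continuousAt_radial_zero hκlim).smul continuousAt_const).add ?_
        rw [continuousAt_iff_punctured_nhds]
        -- The rank-one term has operator norm exactly `|η ‖x‖|`, since the powers of `‖x‖` cancel.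
        have h1 : Tendsto (fun x : EuclideanSpace ℝ (Fin n) => |η ‖x‖|) (𝓝[≠] 0) (𝓝 0) := by
          simpa using (hηlim.comp tendsto_norm_nhdsNE_zero).abs
        simp only [norm_zero, inv_zero, mul_zero, zero_smul]
        refine squeeze_zero_norm' ?_ h1
        filter_upwards [self_mem_nhdsWithin] with y hy
        have hr : 0 < ‖y‖ := norm_pos_iff.2 hy
        rw [norm_smul, ContinuousLinearMap.norm_smulRight_apply, innerSL_apply_norm, norm_mul,
          norm_div, norm_inv, norm_norm, Real.norm_eq_abs]
        refine le_of_eq ?_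
        field_simp
      · have hr : 0 < ‖x‖ := norm_pos_iff.2 hx
        have hnc : ContinuousAt (fun x : EuclideanSpace ℝ (Fin n) => ‖x‖) x :=
          continuous_norm.continuousAt
        have e1 : ContinuousAt (fun x : EuclideanSpace ℝ (Fin n) => κ ‖x‖) x :=
          ContinuousAt.comp (g := κ) (hκd _ hr).continuousAt hnc
        have e2 : ContinuousAt (fun x : EuclideanSpace ℝ (Fin n) => η ‖x‖) x :=
          ContinuousAt.comp (g := η) (hηc _ hr) hnc
        have e3 : Continuous fun x : EuclideanSpace ℝ (Fin n) => (innerSL ℝ x).smulRight x := by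
          fun_prop
        exact (e1.smul continuousAt_const).add
          (((e2.div hnc hr.ne').mul (hnc.inv₀ hr.ne')).smul e3.continuousAt)
    · rcases eq_or_ne x 0 with rfl | hx
      · refine (hasFDerivAt_radialField_zero (continuousAt_radial_zero hκlim)).congr_fderiv ?_
        simp
      · exact hasFDerivAt_radialField_of_ne_zero hx (hκd _ (norm_pos_iff.2 hx))
  have hpd : ∀ (y : EuclideanSpace ℝ (Fin n)) (j : Fin n),
      partialDeriv j (fun x => v ‖x‖) y = -(κ ‖y‖ * y j) := fun y j => by
    rw [partialDeriv, (hfd y).fderiv]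
    simp [EuclideanSpace.inner_single_right]
  refine ⟨?_, fun x => ?_⟩
  · have h2 : (2 : WithTop ℕ∞) = ((1 : ℕ) : WithTop ℕ∞) + 1 := by norm_num
    rw [h2, contDiff_succ_iff_hasFDerivAt]
    exact ⟨_, (innerSL ℝ).contDiff.comp hF.neg, hfd⟩
  · rcases eq_or_ne x 0 with rfl | hx
    · rw [laplaceBeltrami_zero hψ hn hκlim (.of_forall hpd), hκ0, norm_zero]
      field_simp
    · have hr : 0 < ‖x‖ := norm_pos_iff.2 hx
      rw [laplaceBeltrami_of_ne_zero (k := k) (P' := modelWeight ψ n ‖x‖ * g (v ‖x‖)) hψ hn hx]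
      · rw [mul_div_cancel_left₀ _ (hw.pos _ hr.ne').ne']
      · filter_upwards [isOpen_ne.mem_nhds hx] with y hy j
        rw [hpd, hκr _ (norm_pos_iff.2 hy)]
      · have e : (fun r => modelWeight ψ n r * k r) =
            fun r => ∫ t in (0 : ℝ)..r, modelWeight ψ n t * g (v t) :=
          funext fun r => hw.mul_avgFlux _ r
        rw [e]
        exact hw.hasDerivAt_primitive hgv ‖x‖

/-- The radial profile of a positive global solution solves the radial integral equation. -/
theorem IsGlobalPositiveRadialSolution.exists_profile (hψ : IsModelFunction ψ) (hn : 1 ≤ n)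
    (hw : IsRadialWeight (modelWeight ψ n) K) {q : ℝ} (hq : 0 < q)
    {u : EuclideanSpace ℝ (Fin n) → ℝ}
    (hu : IsGlobalPositiveRadialSolution (metric n ψ) q u) :
    ∃ v : ℝ → ℝ, Continuous v ∧ (∀ r, 0 ≤ r → 0 < v r) ∧
      ∀ T, IsProfile (modelWeight ψ n) (fun t => t ^ q) (v 0) T v := by
  have hcw := hw.continuous
  set e : EuclideanSpace ℝ (Fin n) := EuclideanSpace.single ⟨0, hn⟩ 1 with he
  have hen : ‖e‖ = 1 := by simp [he]
  set v : ℝ → ℝ := fun r => u (r • e) with hv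
  have hvC : ContDiff ℝ 2 v := hu.contDiff.comp (contDiff_id.smul contDiff_const)
  have huv : ∀ x, u x = v ‖x‖ := fun x => by
    refine hu.radial x trivial _ trivial ?_
    rw [geodesicDist_zero, geodesicDist_zero, norm_smul, hen, mul_one, norm_norm]
  have hvpos : ∀ r, 0 < v r := fun r => hu.pos _
  have hvd : ∀ r, HasDerivAt v (deriv v r) r := fun r =>
    (hvC.differentiable (by simp) r).hasDerivAt
  have hv1 : ContDiff ℝ 1 (deriv v) := by
    have : ContDiff ℝ (1 + 1) v := hvC.of_le (by norm_num)
    exact (contDiff_succ_iff_deriv.1 this).2.2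
  have hvc : Continuous v := hvC.continuous
  have hvq : Continuous fun t => v t ^ q := hvc.rpow_const fun _ => .inr hq.le
  have hpd : ∀ y : EuclideanSpace ℝ (Fin n), y ≠ 0 → ∀ j,
      partialDeriv j u y = -(-deriv v ‖y‖ / ‖y‖ * y j) := fun y hy j => by
    rw [partialDeriv, show u = fun x => v ‖x‖ from funext huv,
      (hasFDerivAt_radial_of_ne_zero hy (hvd ‖y‖)).fderiv]
    simp [EuclideanSpace.inner_single_right]
    ring
  have hPc : Continuous fun r => modelWeight ψ n r * -deriv v r := hcw.mul hv1.continuous.neg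
  have hPd : ∀ r, 0 < r → HasDerivAt (fun r => modelWeight ψ n r * -deriv v r)
      (modelWeight ψ n r * v r ^ q) r := by
    intro r hr
    have h1 := (hψ.hasDerivAt_modelWeight hn hr).mul
      ((hv1.differentiable (by simp) r).hasDerivAt.neg)
    refine h1.congr_deriv ?_
    have hne : r • e ≠ 0 := smul_ne_zero hr.ne' (norm_ne_zero_iff.1 (by rw [hen]; norm_num))
    have hnorm : ‖r • e‖ = r := by rw [norm_smul, hen, mul_one, Real.norm_of_nonneg hr.le]
    have h2 := laplaceBeltrami_of_ne_zero hψ hn hne (k := fun r => -deriv v r)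
      (by filter_upwards [isOpen_ne.mem_nhds hne] with y hy j; exact hpd y hy j)
      (by rw [hnorm]; exact h1)
    rw [hu.equation, hnorm, eq_div_iff (hw.pos r hr.ne').ne'] at h2
    rw [← h2]
    ring
  -- The equation away from the pole is integrated from `0`; no constant appears because `w 0 = 0`
  -- and `deriv v` is bounded near `0`.
  have hflux : ∀ r, 0 ≤ r → modelWeight ψ n r * -deriv v r =
      ∫ t in (0 : ℝ)..r, modelWeight ψ n t * v t ^ q := by
    intro r hr
    rw [intervalIntegral.integral_eq_sub_of_hasDerivAt_of_le hr hPc.continuousOn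
      (fun t ht => hPd t ht.1) ((hcw.mul hvq).intervalIntegrable _ _), hw.zero, zero_mul, sub_zero]
  refine ⟨v, hvc, fun r _ => hvpos r, fun T r hr => ?_⟩
  have h1 : ∫ s in (0 : ℝ)..r, avgFlux (modelWeight ψ n) (fun t => v t ^ q) s =
      -v r - -v 0 := by
    refine intervalIntegral.integral_eq_sub_of_hasDerivAt_of_le hr.1 hvc.neg.continuousOn
      (fun s hs => ?_) ((hw.continuous_avgFlux hvq).intervalIntegrable _ _)
    refine (hvd s).neg.congr_deriv ?_
    rw [avgFlux, ← hflux s hs.1.le, inv_mul_cancel_left₀ (hw.pos s hs.1.ne').ne']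
  rw [h1]
  ring

theorem isRadialDirichletSolution_of_profile (hψ : IsModelFunction ψ) (hn : 1 ≤ n)
    (hw : IsRadialWeight (modelWeight ψ n) K) {q A a T : ℝ} (hq : 0 < q) (hT : 0 < T)
    {v : ℝ → ℝ} (hv : Continuous v)
    (hva : ∀ r, v r = a - ∫ s in (0 : ℝ)..r,
      avgFlux (modelWeight ψ n) (fun t => truncPow q A (v t)) s)
    (hvT : v T = 0) (hpos : ∀ r ∈ Ico 0 T, 0 < v r) (hA : ∀ r ∈ Icc 0 T, v r ≤ A) :
    IsRadialDirichletSolution (metric n ψ) q T fun x : EuclideanSpace ℝ (Fin n) => v ‖x‖ := by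
  obtain ⟨h1, h2⟩ := contDiff_and_equation_of_profile hψ hn hw (continuous_truncPow hq.le) hv hva
  refine ⟨h1.contDiffOn, h1.continuous.continuousOn, fun x _ y _ hxy => ?_, fun x hx => ?_,
    fun x hx => ?_, fun x hx => ?_⟩
  · rw [geodesicDist_zero, geodesicDist_zero,
      ENNReal.ofReal_eq_ofReal_iff (norm_nonneg x) (norm_nonneg y)] at hxy
    rw [hxy]
  · exact hpos _ ⟨norm_nonneg x, (mem_geodesicBall hT).1 hx⟩
  · have hr : ‖x‖ ∈ Ico 0 T := ⟨norm_nonneg x, (mem_geodesicBall hT).1 hx⟩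
    rw [h2, truncPow_of_mem ⟨(hpos _ hr).le, hA _ (Ico_subset_Icc_self hr)⟩]
  · rw [(mem_geodesicSphere hT).1 hx, hvT]

end Profiles

end ModelManifold

theorem mainTheorem6 (n : ℕ) (hn : 2 ≤ n) (α : ℝ) (hα : 1 < α) (ψ : ℝ → ℝ)
    (hψ : ModelManifold.IsModelFunction ψ) (hgrowth : ModelManifold.HasPowerGrowth ψ α)
    (q : ℝ) (hq : q ∈ Set.Ioo (ModelManifold.tildeTwo n α) (ModelManifold.twoStar n α - 1))
    (hglobal : ∃ u : EuclideanSpace ℝ (Fin n) → ℝ,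
      ModelManifold.IsGlobalPositiveRadialSolution (ModelManifold.metric n ψ) q u) :
    ∃ R : ℝ, 0 < R ∧ ∃ u₁ u₂ : EuclideanSpace ℝ (Fin n) → ℝ,
      ModelManifold.IsRadialDirichletSolution (ModelManifold.metric n ψ) q R u₁ ∧
      ModelManifold.IsRadialDirichletSolution (ModelManifold.metric n ψ) q R u₂ ∧
      ∃ x ∈ ModelManifold.geodesicBall (ModelManifold.metric n ψ) R, u₁ x ≠ u₂ x := by
  have hn1 : 1 ≤ n := by omega
  have hn2 : (2 : ℝ) ≤ n := by exact_mod_cast hn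
  have hd : 1 < α * ((n : ℝ) - 1) := by nlinarith
  have hd' : 0 < α * ((n : ℝ) - 1) - 1 := by linarith
  have hq1 : 1 < q := by
    refine lt_trans ?_ hq.1
    rw [ModelManifold.tildeTwo, one_lt_div hd']
    linarith
  -- With `d = α(n-1)`, `twoStar n α - 1 = (d + 3) / (d - 1)`.
  have hq2 : (q - 1) * (α * ((n : ℝ) - 1) - 1) < 4 := by
    have h := hq.2
    rw [ModelManifold.twoStar, lt_sub_iff_add_lt, lt_div_iff₀ hd'] at h
    linarith
  obtain ⟨K, c, C, hw, hc, hwc, hwC⟩ := hψ.exists_modelWeight_bounds hn hα hgrowth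
  obtain ⟨u, hu⟩ := hglobal
  obtain ⟨v₀, hv₀c, hv₀, hv₀T⟩ := hu.exists_profile hψ hn1 hw (by linarith)
  obtain ⟨T, A, a₁, a₂, hT, -, hne, hsol⟩ := hw.exists_two_dirichlet_profiles hq1
    (fun ε hε => hw.exists_small_dirichlet_profile hc hd hwc hwC hq1 hq2 hε) hv₀c hv₀ hv₀T
  obtain ⟨v₁, hv₁c, hv₁, hv₁0, hv₁T, hv₁p, hv₁A⟩ := hsol a₁ (.inl rfl)
  obtain ⟨v₂, hv₂c, hv₂, hv₂0, hv₂T, hv₂p, hv₂A⟩ := hsol a₂ (.inr rfl)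
  refine ⟨T, hT, _, _,
    ModelManifold.isRadialDirichletSolution_of_profile hψ hn1 hw (by linarith) hT hv₁c hv₁ hv₁T
      hv₁p hv₁A,
    ModelManifold.isRadialDirichletSolution_of_profile hψ hn1 hw (by linarith) hT hv₂c hv₂ hv₂T
      hv₂p hv₂A, 0, ?_, ?_⟩
  -- The two solutions are told apart at the pole, where their values are the distinct heights `a₁`
  -- and `a₂`.
  · rw [ModelManifold.mem_geodesicBall hT, norm_zero]
    exact hT
  · simp only [norm_zero, hv₁0, hv₂0]
    exact hne
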